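/- **Setting.** Let $\mathcal X$ be a measurable space, $\mathcal Y$ a finite set, $\mu$ a probability distribution on $\mathcal X$. A model is a Markov kernel $\pi:\mathcal X\to\Delta(\mathcal Y)$. Fix a base model $\pi_{\rm base}$, a class $\Pi$ of models, and the self-reward $r(x,y)=\log\pi_{\rm base}(y\mid x)$. Let $\mathbf y^\star(x)=\arg\max_{y}\pi_{\rm base}(y\mid x)$ (a set). A model $\pi$ is $(\epsilon,\delta)$-sharpened if $\mathbb P_{x\sim\mu}[\pi(\mathbf y^\star(x)\mid x)\ge 1-\delta]\ge 1-\epsilon$. For $\beta>0$ put $\pi^\star_\beta(y\mid x)\propto\pi_{\rm base}(y\mid x)^{1+1/\beta}$ and $J_\beta(\pi)=\mathbb E_\pi[r(x,y)]-\beta D_{\rm KL}(\mathbb P^\pi\|\mathbb P^{\pi_{\rm base}})$, where $\mathbb P^\pi$ is the law of $(x,y)$ with $x\sim\mu$, $y\sim\pi(\cdot\mid x)$. With $\Delta_\pi(x,y,y')=\beta\log\frac{\pi(y\mid x)}{\pi_{\rm base}(y\mid x)}-r(x,y)-\beta\log\frac{\pi(y'\mid x)}{\pi_{\rm base}(y'\mid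 x)}+r(x,y')$, the Sequential Extrapolation Coefficient is $$\mathsf{SEC}_T(\Pi)=\sup_{\pi^{(1)},\dots,\pi^{(T)}\in\Pi}\ \sum_{t=1}^T\frac{\big(\mathbb E^{(t)}[\Delta_{\pi^{(t)}}]\big)^2}{R_{\max}^2\vee\sum_{i<t}\mathbb E^{(i)}[\Delta_{\pi^{(t)}}^2]},$$ where $\mathbb E^{(t)}$ is over $x\sim\mu$, $y\sim\pi^{(t)}(\cdot\mid x)$, $y'\sim\pi_{\rm base}(\cdot\mid x)$. Let $\mathcal N(\Pi,\eta)$ be the least size of a set $\Psi\subseteq\Pi$ such that every $\pi\in\Pi$ has a $\pi'\in\Psi$ with $|\log(\pi(y\mid x)/\pi'(y\mid x))|\le\eta$ for all $x,y$. **Algorithm (reward-based XPO)** with inputs $\pi_{\rm base}, r, T,\beta,\alpha$: set $\pi^{(1)}=\pi_{\rm base}$; for $t=1,\dots,T$ draw $x^{(t)}\sim\mu$, $y^{(t)}\sim\pi^{(t)}(\cdot\mid x^{(t)})$, $\tilde y^{(t)}\sim\pi_{\rm base}(\cdot\mid x^{(t)})$, and let $\pi^{(t+1)}$ be an exact minimizer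 over $\pi\in\Pi$ of $$\alpha\sum_{i\le t}\log\pi(\tilde y^{(i)}\mid x^{(i)})+\sum_{i\le t}\Big(\beta\log\tfrac{\pi(y^{(i)}\mid x^{(i)})}{\pi_{\rm base}(y^{(i)}\mid x^{(i)})}-\beta\log\tfrac{\pi(\tilde y^{(i)}\mid x^{(i)})}{\pi_{\rm base}(\tilde y^{(i)}\mid x^{(i)})}-\big(r(x^{(i)},y^{(i)})-r(x^{(i)},\tilde y^{(i)})\big)\Big)^2 ,$$ chosen measurably from the data. Return $\hat\pi\in\arg\max_{t\in[T+1]}J_\beta(\pi^{(t)})$. Each round uses two sample-and-evaluate queries, so the sample complexity is $m=2T$. **Theorem.** There are absolute constants $c,C,C'>0$ such that the following holds. Let $\epsilon,\delta,\gamma_{\rm margin},\rho,\beta,\epsilon_{\rm disc}\in(0,1)$, $T\ge1$ and $R_{\max}\in\mathbb R$. Suppose that 1. $\pi_{\rm base}(y\mid x)>0$ and $1+\log\frac1{\pi_{\rm base}(y\mid x)}\le R_{\max}$ for all $x,y$; 2. $\pi(y\mid x)>0$ and $\big|\beta\log\frac{\pi(y\mid x)}{\pi_{\rm base}(y\mid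 x)}\big|\le R_{\max}$ for all $\pi\in\Pi$ and all $x,y$; 3. (margin) for $\mu$-almost every $x$ and all $y'\notin\mathbf y^\star(x)$, $\max_y\pi_{\rm base}(y\mid x)\ge(1+\gamma_{\rm margin})\pi_{\rm base}(y'\mid x)$; 4. $\beta^{-1}\ge 2\gamma_{\rm margin}^{-1}\log(2|\mathcal Y|/\delta)$; 5. (realizability) $\pi^\star_\beta\in\Pi$; 6. with $S=\max\{\mathsf{SEC}_T(\Pi),1\}$ and $N=\mathcal N(\Pi,\epsilon_{\rm disc})<\infty$, $$T\ \ge\ C\,\frac{R_{\max}^2\,S\,\log(2NT/\rho)}{\epsilon^2\delta^2\beta^2},\qquad \epsilon_{\rm disc}\le c\,\frac{\epsilon\delta}{\sqrt{S\,T}} .$$ (i) For $\alpha=\frac{\beta}{R_{\max}}\sqrt{\frac{\log(2NT/\kappa)}{S\,T}}$ with $\kappa=\delta$ or $\kappa=\rho$, with probability at least $1-\rho$ every output $\hat\pi$ of the algorithm is $(\epsilon,\delta)$-sharpened, and it lies in $\Pi$ if $\pi_{\rm base}\in\Pi$. (ii) If moreover $\beta=\gamma_{\rm margin}/(2\log(2|\mathcal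 Y|/\delta))$ and $T$ is the lower bound in 6 rounded up (that is, $T$ is smaller than that bound plus one), then the sample complexity satisfies $m\le C' g\max\{1,\log g\}$, that is $m=\tilde O(g)$, where $$g=\frac{R_{\max}^2\,S\,\log(2N/\rho)\,\log^2(2|\mathcal Y|/\delta)}{\gamma_{\rm margin}^2\,\epsilon^2\,\delta^2},$$ with no dependence on a coverage coefficient. -/

import Mathlib

open MeasureTheory ProbabilityTheory

noncomputable section

namespace XPO

variable {X Y : Type*} [MeasurableSpace X] [MeasurableSpace Y]

/-- A model `π : X → Δ(Y)` is a Markov kernel from prompts to responses;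
`prob π x y` is the probability `π(y ∣ x)`. -/
def prob (π : Kernel X Y) (x : X) (y : Y) : ℝ := (π x).real {y}

/-- The arg-max responses `y⋆(x)` of the base model. -/
def argmaxSet (base : Kernel X Y) (x : X) : Set Y :=
  {y | ∀ y', prob base x y' ≤ prob base x y}

/-- `π` is `(ε, δ)`-sharpened relative to `base`:
`ℙ_{x ∼ μ}[π(y⋆(x) ∣ x) ≥ 1 - δ] ≥ 1 - ε`. -/
def IsSharpened (μ : Measure X) (base π : Kernel X Y) (ε δ : ℝ) : Prop :=
  1 - ε ≤ μ.real {x | 1 - δ ≤ (π x).real (argmaxSet base x)}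

/-- The margin condition: for `μ`-almost every prompt, the largest base probability exceeds that of
every response outside the arg-max set by a factor `1 + γ`. -/
def MarginCondition (μ : Measure X) (base : Kernel X Y) (γ : ℝ) : Prop :=
  ∀ᵐ x ∂μ, ∀ y', y' ∉ argmaxSet base x → (1 + γ) * prob base x y' ≤ ⨆ y, prob base x y

/-- `π(y ∣ x) = base(y ∣ x)^(1 + 1/β) / ∑ y', base(y' ∣ x)^(1 + 1/β)`. -/
def IsPowerTilt [Fintype Y] (base : Kernel X Y) (β : ℝ) (π : Kernel X Y) : Prop :=
  ∀ x y, prob π x y = prob base x y ^ (1 + β⁻¹) / ∑ y', prob base x y' ^ (1 + β⁻¹)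

/-- Density ratios of the class with respect to `base` are well defined and bounded:
`|β log (π(y ∣ x) / base(y ∣ x))| ≤ V` for all `π`, `x`, `y`. -/
def BoundedDensityRatios (base : Kernel X Y) (models : Set (Kernel X Y)) (β V : ℝ) : Prop :=
  ∀ π ∈ models, ∀ x y, 0 < prob π x y ∧ |β * Real.log (prob π x y / prob base x y)| ≤ V

/-- The self-reward `log base(y ∣ x)`. -/
def selfReward (base : Kernel X Y) (x : X) (y : Y) : ℝ := Real.log (prob base x y)

/-- `β log (π(y∣x)/base(y∣x)) - r(x,y) - β log (π(y'∣x)/base(y'∣x)) + r(x,y')` at `z = (x, y, y')`. -/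
def residual (base : Kernel X Y) (r : X → Y → ℝ) (β : ℝ) (π : Kernel X Y) (z : X × Y × Y) : ℝ :=
  β * Real.log (prob π z.1 z.2.1 / prob base z.1 z.2.1) - r z.1 z.2.1
    - β * Real.log (prob π z.1 z.2.2 / prob base z.1 z.2.2) + r z.1 z.2.2

/-- The law of `(x, y, y')` with `x ∼ μ`, `y ∼ π(· ∣ x)` and `y' ∼ base(· ∣ x)`, the two
responses being conditionally independent given `x`. -/
def roundLaw (μ : Measure X) (base π : Kernel X Y) : Measure (X × Y × Y) := μ ⊗ₘ (π ×ₖ base)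

/-- The sum inside the Sequential Extrapolation Coefficient for the models `p 0, …, p (T - 1)`. -/
def secSum (μ : Measure X) (base : Kernel X Y) (r : X → Y → ℝ) (β lam : ℝ) {T : ℕ}
    (p : Fin T → Kernel X Y) : ℝ :=
  ∑ t : Fin T, (∫ z, residual base r β (p t) z ∂(roundLaw μ base (p t))) ^ 2 /
    max lam (∑ i ∈ Finset.Iio t, ∫ z, residual base r β (p t) z ^ 2 ∂(roundLaw μ base (p i)))

/-- The Sequential Extrapolation Coefficient `SEC(models, r, T, β, lam; base)`. The supremum is over
a bounded set as soon as the density ratios and `r` are bounded and `lam > 0`. -/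
def SEC (μ : Measure X) (models : Set (Kernel X Y)) (r : X → Y → ℝ) (T : ℕ) (β lam : ℝ)
    (base : Kernel X Y) : ℝ :=
  ⨆ p : Fin T → models, secSum μ base r β lam (fun t => (p t : Kernel X Y))

/-- `Ψ` is an `η`-net for the model class, in the uniform metric on log-probabilities. -/
def IsNet (models Ψ : Set (Kernel X Y)) (η : ℝ) : Prop :=
  Ψ ⊆ models ∧ ∀ π ∈ models, ∃ π' ∈ Ψ, ∀ x y, |Real.log (prob π x y / prob π' x y)| ≤ η

/-- The size of the smallest `η`-net (`⊤` if there is no finite one). -/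
def coveringNumber (models : Set (Kernel X Y)) (η : ℝ) : ℕ∞ :=
  ⨅ Ψ ∈ {Ψ : Set (Kernel X Y) | IsNet models Ψ η}, Ψ.encard

/-- The KL-regularized value `J_β(π) = 𝔼_π[r] - β KL(ℙ^π ‖ ℙ^base)`, where `ℙ^π = μ ⊗ₘ π`. -/
def regValue (μ : Measure X) (base : Kernel X Y) (r : X → Y → ℝ) (β : ℝ) (π : Kernel X Y) : ℝ :=
  ∫ z, r z.1 z.2 ∂(μ ⊗ₘ π) - β * (InformationTheory.klDiv (μ ⊗ₘ π) (μ ⊗ₘ base)).toReal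

/-- The optimistic least-squares objective on a dataset of triples `(x, y, y')`: squared residuals
plus the global optimism bonus `α ∑ log π(y' ∣ x)`. -/
def objective (base : Kernel X Y) (r : X → Y → ℝ) (β α : ℝ) {t : ℕ} (D : Fin t → X × Y × Y)
    (π : Kernel X Y) : ℝ :=
  α * ∑ i, Real.log (prob π (D i).1 (D i).2.2)
    + ∑ i, (β * Real.log (prob π (D i).1 (D i).2.1 / prob base (D i).1 (D i).2.1)
        - β * Real.log (prob π (D i).1 (D i).2.2 / prob base (D i).1 (D i).2.2)
        - (r (D i).1 (D i).2.1 - r (D i).1 (D i).2.2)) ^ 2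

/-- A model-selection rule: `A t` takes the dataset `D` of the first `t` rounds and a prompt to a
distribution over responses, jointly measurably in both. -/
abbrev Rule (X Y : Type*) [MeasurableSpace X] [MeasurableSpace Y] :=
  (t : ℕ) → Kernel ((Fin t → X × Y × Y) × X) Y

/-- The model `π^(t+1)` that the rule selects after the `t` rounds recorded in `D`. -/
def Rule.model (A : Rule X Y) {t : ℕ} (D : Fin t → X × Y × Y) : Kernel X Y := (A t).sectR D

/-- `A` is the model-selection rule of reward-based XPO with `T` iterations: `π^(1) = base`, and
after each round the next model is an exact minimizer of the objective over the model class. -/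
structure IsXPORule (base : Kernel X Y) (r : X → Y → ℝ) (models : Set (Kernel X Y)) (T : ℕ)
    (β α : ℝ) (A : Rule X Y) : Prop where
  markov : ∀ t, IsMarkovKernel (A t)
  init : ∀ D : Fin 0 → X × Y × Y, A.model D = base
  mem : ∀ t, 1 ≤ t → t ≤ T → ∀ D : Fin t → X × Y × Y, A.model D ∈ models
  minimizes : ∀ t, 1 ≤ t → t ≤ T → ∀ D : Fin t → X × Y × Y, ∀ π ∈ models,
    objective base r β α D (A.model D) ≤ objective base r β α D π

/-- One round: given the dataset `D` of the first `t` rounds, sample `x ∼ μ`, then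
`y ∼ π^(t+1)(· ∣ x)` and, independently given `x`, `y' ∼ base(· ∣ x)`. -/
def roundKernel (μ : Measure X) (base : Kernel X Y) (A : Rule X Y) (t : ℕ) :
    Kernel (Fin t → X × Y × Y) (X × Y × Y) :=
  Kernel.const _ μ ⊗ₖ (A t ×ₖ base.comap Prod.snd measurable_snd)

/-- The joint law of the dataset collected in `t` rounds. -/
def datasetLaw (μ : Measure X) (base : Kernel X Y) (A : Rule X Y) :
    (t : ℕ) → Measure (Fin t → X × Y × Y)
  | 0 => Measure.dirac Fin.elim0
  | t + 1 => (datasetLaw μ base A t ⊗ₘ roundKernel μ base A t).map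
      (fun p => Fin.snoc (α := fun _ => X × Y × Y) p.1 p.2)

/-- The model `π^(t+1)`, `t ≤ T`, of a run whose full dataset is `D`. -/
def Rule.iterate (A : Rule X Y) {T : ℕ} (D : Fin T → X × Y × Y) (t : Fin (T + 1)) : Kernel X Y :=
  A.model (t := (t : ℕ)) (fun i => D (Fin.castLE (Nat.le_of_lt_succ t.isLt) i))

/-- `out` is an output of the run with dataset `D`: a maximizer of `J_β` among
`π^(1), …, π^(T+1)`. -/
def IsOutput (μ : Measure X) (base : Kernel X Y) (r : X → Y → ℝ) (β : ℝ) (A : Rule X Y) {T : ℕ}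
    (D : Fin T → X × Y × Y) (out : Kernel X Y) : Prop :=
  ∃ t, out = A.iterate D t ∧
    ∀ s, regValue μ base r β (A.iterate D s) ≤ regValue μ base r β (A.iterate D t)

/-- Number of sample-and-evaluate queries in `T` iterations: two responses are drawn and evaluated
per prompt, one from the current model and one from the base model. -/
def queryCount (T : ℕ) : ℕ := ∑ _t : Fin T, 2

/-- The optimism coefficient `(β / R) √(log (2 N T / κ) / (S T))` at confidence level `κ`. -/
def optimismCoeff (β R S : ℝ) (N T : ℕ) (κ : ℝ) : ℝ :=
  β / R * Real.sqrt (Real.log (2 * N * T / κ) / (S * T))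

/-- The requirement `R² S log (2 N T / ρ) / (ε² δ² β²)` on the number of iterations, without its
absolute constant. -/
def iterationBound (β R S : ℝ) (N T : ℕ) (ε δ ρ : ℝ) : ℝ :=
  R ^ 2 * S * Real.log (2 * N * T / ρ) / (ε ^ 2 * δ ^ 2 * β ^ 2)

/-- The rate `R² S log (2 N / ρ) log² (2 K / δ) / (γ² ε² δ²)`, with `K = |Y|`. -/
def sampleRate (R S : ℝ) (N K : ℕ) (γ ε δ ρ : ℝ) : ℝ :=
  R ^ 2 * S * Real.log (2 * N / ρ) * Real.log (2 * K / δ) ^ 2 / (γ ^ 2 * ε ^ 2 * δ ^ 2)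

end XPO

end

namespace XPO

open scoped ENNReal

variable {X Y : Type*} [MeasurableSpace X] [MeasurableSpace Y]

/-! The power tilt `tilt` maximizes `J_β`: the value of `π` is a constant minus `β KL(π ‖ tilt)`
(`regValue_eq`), so regret is a KL divergence. The margin and the size of `1/β` put all but `δ/2` of
the tilt's mass on the arg-max set. Markov's inequality and a change of measure then turn `KL ≤
εδ/6` into sharpening (`isSharpened_of_integral_le`). It remains to bound the regret of the best
iterate by the average regret.

Under realizability the residual of `π` is the difference of `β log (π/tilt)` at `y` and `y'`, so
the regret is the on-policy mean residual plus `β 𝔼_base[log (π/tilt)]` (`regret_eq`). Comparing the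
minimizer with `tilt`, whose residuals vanish, bounds its empirical squared residuals by `α` times
its log-likelihood deficit on the base samples (`optimism`). Exponential supermartingales and a
union bound over rounds and a finite net carry this over to population quantities
(`sum_integral_residual_sq_le`). The SEC relates the on-policy mean residual to the squared
residuals under earlier policies. A weighted AM-GM is tuned so that the resulting likelihood deficit
cancels the second term of the regret. What is left sums to order `R √(L S T)`, with `L = log
(2NT/ρ)`, plus the net error (`sum_regret_le`); the lower bound on `T` makes this at most `T β ε δ /
6`. No coverage coefficient enters, because the data come from the iterates themselves.

For the sample complexity, `T` satisfies a self-bounding inequality `T ≲ g (1 + 2 log T)`, which is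
solved for `T`. -/

lemma ofReal_prob (π : Kernel X Y) [IsMarkovKernel π] (x : X) (y : Y) :
    ENNReal.ofReal (prob π x y) = π x {y} :=
  ofReal_measureReal

lemma prob_nonneg (π : Kernel X Y) (x : X) (y : Y) : 0 ≤ prob π x y := measureReal_nonneg

lemma map_roundLaw_fst (μ : Measure X) [IsProbabilityMeasure μ] (base π : Kernel X Y)
    [IsMarkovKernel π] [IsMarkovKernel base] :
    (roundLaw μ base π).map (fun z => (z.1, z.2.1)) = μ ⊗ₘ π := by
  conv_rhs => rw [← Kernel.fst_prod π base, Kernel.fst_eq, Measure.compProd_map measurable_fst]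
  rfl

lemma map_roundLaw_snd (μ : Measure X) [IsProbabilityMeasure μ] (base π : Kernel X Y)
    [IsMarkovKernel π] [IsMarkovKernel base] :
    (roundLaw μ base π).map (fun z => (z.1, z.2.2)) = μ ⊗ₘ base := by
  conv_rhs => rw [← Kernel.snd_prod π base, Kernel.snd_eq, Measure.compProd_map measurable_snd]
  rfl

instance (μ : Measure X) [IsProbabilityMeasure μ] (base π : Kernel X Y)
    [IsMarkovKernel π] [IsMarkovKernel base] :
    IsProbabilityMeasure (roundLaw μ base π) := by
  unfold roundLaw; infer_instance

lemma integrable_of_abs_le {α : Type*} [MeasurableSpace α] {ν : Measure α} [IsFiniteMeasure ν]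
    {f : α → ℝ} (hf : Measurable f) {C : ℝ} (h : ∀ a, |f a| ≤ C) : Integrable f ν :=
  Integrable.of_bound hf.aestronglyMeasurable C (ae_of_all _ h)

lemma integral_roundLaw_fst (μ : Measure X) [IsProbabilityMeasure μ] (base π : Kernel X Y)
    [IsMarkovKernel π] [IsMarkovKernel base]
    {f : X × Y → ℝ} (hf : Measurable f) :
    ∫ z, f (z.1, z.2.1) ∂(roundLaw μ base π) = ∫ z, f z ∂(μ ⊗ₘ π) := by
  rw [← map_roundLaw_fst μ base π, integral_map (by fun_prop) hf.aestronglyMeasurable]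

lemma integral_roundLaw_snd (μ : Measure X) [IsProbabilityMeasure μ] (base π : Kernel X Y)
    [IsMarkovKernel π] [IsMarkovKernel base]
    {f : X × Y → ℝ} (hf : Measurable f) :
    ∫ z, f (z.1, z.2.2) ∂(roundLaw μ base π) = ∫ z, f z ∂(μ ⊗ₘ base) := by
  rw [← map_roundLaw_snd μ base π, integral_map (by fun_prop) hf.aestronglyMeasurable]

/-! ### Finite response spaces: densities, KL divergence, measurability. -/

section Probabilities

variable [Fintype Y] [MeasurableSingletonClass Y]

lemma measurable_prob (π : Kernel X Y) : Measurable fun z : X × Y => prob π z.1 z.2 := by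
  refine measurable_from_prod_countable_left fun y => ?_
  exact (Kernel.measurable_coe π (measurableSet_singleton y)).ennreal_toReal

lemma real_eq_sum_prob (π : Kernel X Y) [IsMarkovKernel π] (x : X) (s : Set Y)
    [DecidablePred (· ∈ s)] : (π x).real s = ∑ y, if y ∈ s then prob π x y else 0 := by
  rw [← Finset.sum_filter]
  simp [prob]

lemma sum_prob (π : Kernel X Y) [IsMarkovKernel π] (x : X) : ∑ y, prob π x y = 1 := by
  classical
  simpa using (real_eq_sum_prob π x Set.univ).symm

/-- The log-likelihood ratio `log (π(y ∣ x) / ref(y ∣ x))`. -/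
noncomputable def logRatio (π ref : Kernel X Y) (z : X × Y) : ℝ :=
  Real.log (prob π z.1 z.2 / prob ref z.1 z.2)

lemma measurable_logRatio (π ref : Kernel X Y) : Measurable (logRatio π ref) :=
  Real.measurable_log.comp ((measurable_prob π).div (measurable_prob ref))

variable (μ : Measure X) [IsProbabilityMeasure μ]

lemma compProd_eq_withDensity (π base : Kernel X Y) [IsMarkovKernel π] [IsMarkovKernel base]
    (hb : ∀ x y, 0 < prob base x y) :
    μ ⊗ₘ π = (μ ⊗ₘ base).withDensity
      fun z => ENNReal.ofReal (prob π z.1 z.2 / prob base z.1 z.2) := by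
  have hm : Measurable fun z : X × Y => ENNReal.ofReal (prob π z.1 z.2 / prob base z.1 z.2) :=
    ((measurable_prob π).div (measurable_prob base)).ennreal_ofReal
  refine Measure.ext_of_lintegral _ fun f hf => ?_
  rw [lintegral_withDensity_eq_lintegral_mul _ hm hf, Measure.lintegral_compProd hf,
    Measure.lintegral_compProd (hm.mul hf)]
  refine lintegral_congr fun x => ?_
  rw [lintegral_fintype, lintegral_fintype]
  refine Finset.sum_congr rfl fun y _ => ?_
  rw [← ofReal_prob π, ← ofReal_prob base, Pi.mul_apply, mul_comm, mul_right_comm,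
    ← ENNReal.ofReal_mul (div_nonneg (prob_nonneg _ _ _) (prob_nonneg _ _ _)),
    div_mul_cancel₀ _ (hb x y).ne']

/-- The Radon–Nikodym derivative is the ratio of response probabilities, and the two laws have equal
mass, so the mass correction in `klDiv` vanishes. -/
lemma toReal_klDiv_compProd (π base : Kernel X Y) [IsMarkovKernel π] [IsMarkovKernel base]
    (hb : ∀ x y, 0 < prob base x y) :
    (InformationTheory.klDiv (μ ⊗ₘ π) (μ ⊗ₘ base)).toReal = ∫ z, logRatio π base z ∂(μ ⊗ₘ π) := by
  have hd := compProd_eq_withDensity μ π base hb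
  have hm : Measurable fun z : X × Y => ENNReal.ofReal (prob π z.1 z.2 / prob base z.1 z.2) :=
    ((measurable_prob π).div (measurable_prob base)).ennreal_ofReal
  have hac : μ ⊗ₘ π ≪ μ ⊗ₘ base := hd ▸ withDensity_absolutelyContinuous _ _
  rw [InformationTheory.toReal_klDiv_of_measure_eq hac (by simp)]
  refine integral_congr_ae (hac.ae_le ?_)
  have hr := Measure.rnDeriv_withDensity (μ ⊗ₘ base) hm
  rw [← hd] at hr
  filter_upwards [hr] with z hz
  rw [llr, hz, ENNReal.toReal_ofReal (div_nonneg (prob_nonneg _ _ _) (prob_nonneg _ _ _)), logRatio]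

lemma measurable_residual (base : Kernel X Y) {r : X → Y → ℝ}
    (hr : Measurable fun z : X × Y => r z.1 z.2) (β : ℝ) (π : Kernel X Y) :
    Measurable (residual base r β π) := by
  have h1 := (measurable_logRatio π base).comp
    (measurable_fst.prodMk (measurable_fst.comp measurable_snd) :
      Measurable fun z : X × Y × Y => (z.1, z.2.1))
  have h2 := (measurable_logRatio π base).comp
    (measurable_fst.prodMk (measurable_snd.comp measurable_snd) :
      Measurable fun z : X × Y × Y => (z.1, z.2.2))
  have h3 := hr.comp (measurable_fst.prodMk (measurable_fst.comp measurable_snd) :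
      Measurable fun z : X × Y × Y => (z.1, z.2.1))
  have h4 := hr.comp (measurable_fst.prodMk (measurable_snd.comp measurable_snd) :
      Measurable fun z : X × Y × Y => (z.1, z.2.2))
  exact (((h1.const_mul β).sub h3).sub (h2.const_mul β)).add h4

lemma measurable_selfReward (base : Kernel X Y) :
    Measurable fun z : X × Y => selfReward base z.1 z.2 :=
  Real.measurable_log.comp (measurable_prob base)

end Probabilities

/-! ### The adaptive data process and its exponential supermartingales. -/

section Dataset

variable (μ : Measure X) [IsProbabilityMeasure μ] (base : Kernel X Y) [IsMarkovKernel base]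
  (A : Rule X Y)

lemma roundKernel_apply (hA : ∀ t, IsMarkovKernel (A t)) (t : ℕ) (D : Fin t → X × Y × Y) :
    roundKernel μ base A t D = roundLaw μ base (A.model D) := by
  have := hA t
  have : IsMarkovKernel (A.model D) := by unfold Rule.model; infer_instance
  rw [roundKernel, Kernel.compProd_apply_eq_compProd_sectR, Kernel.const_apply, roundLaw]
  congr 1
  ext1 x
  rw [Kernel.sectR_apply, Kernel.prod_apply, Kernel.prod_apply]
  rfl

lemma isMarkovKernel_roundKernel (hA : ∀ t, IsMarkovKernel (A t)) (t : ℕ) :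
    IsMarkovKernel (roundKernel μ base A t) := by
  have := hA t
  unfold roundKernel
  infer_instance

lemma measurable_snoc (t : ℕ) : Measurable fun p : (Fin t → X × Y × Y) × (X × Y × Y) =>
    Fin.snoc (α := fun _ => X × Y × Y) p.1 p.2 := by
  refine measurable_pi_lambda _ fun i => ?_
  refine Fin.lastCases ?_ (fun j => ?_) i
  · simpa using measurable_snd
  · simp only [Fin.snoc_castSucc]
    exact (measurable_pi_apply j).comp measurable_fst

lemma isProbabilityMeasure_datasetLaw (hA : ∀ t, IsMarkovKernel (A t)) (t : ℕ) :
    IsProbabilityMeasure (datasetLaw μ base A t) := by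
  induction t with
  | zero => rw [datasetLaw]; infer_instance
  | succ t ih =>
    have := isMarkovKernel_roundKernel μ base A hA t
    rw [datasetLaw]
    exact Measure.isProbabilityMeasure_map (measurable_snoc t).aemeasurable

/-- The first `n` rounds of a dataset. -/
def truncate {n T : ℕ} (h : n ≤ T) (D : Fin T → X × Y × Y) : Fin n → X × Y × Y :=
  fun i => D (Fin.castLE h i)

lemma measurable_truncate {n T : ℕ} (h : n ≤ T) :
    Measurable (truncate (X := X) (Y := Y) h) :=
  measurable_pi_lambda _ fun _ => measurable_pi_apply _

/-- Consistency of the laws: tail bounds proved for `n` rounds become bounds on events of the full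
run. -/
lemma map_truncate_datasetLaw (hA : ∀ t, IsMarkovKernel (A t)) {n T : ℕ} (h : n ≤ T) :
    (datasetLaw μ base A T).map (truncate h) = datasetLaw μ base A n := by
  induction T, h using Nat.le_induction with
  | base => exact Measure.map_id
  | succ T h ih =>
    have := isMarkovKernel_roundKernel μ base A hA T
    have := isProbabilityMeasure_datasetLaw μ base A hA T
    have hcomp : (truncate (h.trans T.le_succ)) ∘
        (fun p : (Fin T → X × Y × Y) × (X × Y × Y) =>
          Fin.snoc (α := fun _ => X × Y × Y) p.1 p.2) = truncate h ∘ Prod.fst := by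
      funext p i
      exact Fin.snoc_castSucc (α := fun _ => X × Y × Y) p.2 p.1 (Fin.castLE h i)
    rw [datasetLaw, Measure.map_map (measurable_truncate _) (measurable_snoc T), hcomp,
      ← Measure.map_map (measurable_truncate h) measurable_fst, ← Measure.fst,
      Measure.fst_compProd, ih]

/-- Ville's argument: conditional expectations at most one multiply. -/
lemma lintegral_prod_datasetLaw_le_one (hA : ∀ t, IsMarkovKernel (A t))
    (W : (i : ℕ) → (Fin i → X × Y × Y) → X × Y × Y → ℝ≥0∞)
    (hW : ∀ i, Measurable fun p : (Fin i → X × Y × Y) × (X × Y × Y) => W i p.1 p.2)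
    (h1 : ∀ i D, ∫⁻ z, W i D z ∂(roundKernel μ base A i D) ≤ 1) (n : ℕ) :
    ∫⁻ D, ∏ i : Fin n, W i (truncate i.isLt.le D) (D i) ∂(datasetLaw μ base A n) ≤ 1 := by
  have hmeas : ∀ n : ℕ, Measurable fun D : Fin n → X × Y × Y =>
      ∏ i : Fin n, W i (truncate i.isLt.le D) (D i) := fun n =>
    Finset.measurable_prod _ fun i _ =>
      (hW i).comp ((measurable_truncate _).prodMk (measurable_pi_apply i))
  induction n with
  | zero => simp [datasetLaw]
  | succ n ih =>
    have := isMarkovKernel_roundKernel μ base A hA n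
    have := isProbabilityMeasure_datasetLaw μ base A hA n
    have hsplit : ∀ p : (Fin n → X × Y × Y) × (X × Y × Y),
        ∏ i : Fin (n + 1), W i (truncate i.isLt.le (Fin.snoc (α := fun _ => X × Y × Y) p.1 p.2))
          (Fin.snoc (α := fun _ => X × Y × Y) p.1 p.2 i)
        = (∏ i : Fin n, W i (truncate i.isLt.le p.1) (p.1 i)) * W n p.1 p.2 := by
      intro p
      rw [Fin.prod_univ_castSucc]
      congr 1
      · refine Finset.prod_congr rfl fun i _ => ?_
        rw [Fin.snoc_castSucc (α := fun _ => X × Y × Y)]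
        congr 1
        funext j
        exact Fin.snoc_castSucc (α := fun _ => X × Y × Y) p.2 p.1 (Fin.castLE i.isLt.le j)
      · rw [Fin.snoc_last]
        congr 1
        funext j
        exact Fin.snoc_castSucc (α := fun _ => X × Y × Y) p.2 p.1 j
    rw [datasetLaw, lintegral_map (hmeas _) (measurable_snoc n)]
    simp_rw [hsplit]
    have hprod : Measurable fun p : (Fin n → X × Y × Y) × (X × Y × Y) =>
        (∏ i : Fin n, W i (truncate i.isLt.le p.1) (p.1 i)) * W n p.1 p.2 :=
      ((hmeas n).comp measurable_fst).mul (hW n)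
    rw [Measure.lintegral_compProd hprod]
    refine le_trans (lintegral_mono fun D => ?_) ih
    have hz : Measurable fun z => W n D z := (hW n).comp measurable_prodMk_left
    dsimp only
    rw [lintegral_const_mul _ hz]
    exact mul_le_of_le_one_right' (h1 n D)

/-- Markov's inequality for the exponential of the sum, whose mean is at most one. -/
lemma datasetLaw_tail_le (hA : ∀ t, IsMarkovKernel (A t))
    (V : (i : ℕ) → (Fin i → X × Y × Y) → X × Y × Y → ℝ)
    (hV : ∀ i, Measurable fun p : (Fin i → X × Y × Y) × (X × Y × Y) => V i p.1 p.2)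
    (h1 : ∀ i D, ∫⁻ z, ENNReal.ofReal (Real.exp (V i D z)) ∂(roundKernel μ base A i D) ≤ 1)
    (n : ℕ) (L : ℝ) :
    datasetLaw μ base A n {D | L ≤ ∑ i : Fin n, V i (truncate i.isLt.le D) (D i)}
      ≤ ENNReal.ofReal (Real.exp (-L)) := by
  have hW : ∀ i, Measurable fun p : (Fin i → X × Y × Y) × (X × Y × Y) =>
      ENNReal.ofReal (Real.exp (V i p.1 p.2)) := fun i => (hV i).exp.ennreal_ofReal
  have hle := lintegral_prod_datasetLaw_le_one μ base A hA
    (fun i D z => ENNReal.ofReal (Real.exp (V i D z))) hW h1 n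
  have hmeas : Measurable fun D : Fin n → X × Y × Y =>
      ∏ i : Fin n, ENNReal.ofReal (Real.exp (V i (truncate i.isLt.le D) (D i))) :=
    Finset.measurable_prod _ fun i _ =>
      (hW i).comp ((measurable_truncate _).prodMk (measurable_pi_apply i))
  have hsub : {D | L ≤ ∑ i : Fin n, V i (truncate i.isLt.le D) (D i)} ⊆
      {D : Fin n → X × Y × Y | ENNReal.ofReal (Real.exp L) ≤
        ∏ i : Fin n, ENNReal.ofReal (Real.exp (V i (truncate i.isLt.le D) (D i)))} := by
    intro D hD
    rw [Set.mem_ofPred_eq, ← ENNReal.ofReal_prod_of_nonneg fun _ _ => (Real.exp_pos _).le,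
      ← Real.exp_sum]
    exact ENNReal.ofReal_le_ofReal (Real.exp_le_exp.2 hD)
  refine (measure_mono hsub).trans ((meas_ge_le_lintegral_div hmeas.aemeasurable
    (by simp [Real.exp_pos]) ENNReal.ofReal_ne_top).trans ?_)
  rw [Real.exp_neg, ENNReal.ofReal_inv_of_pos (Real.exp_pos _), ← one_div]
  exact ENNReal.div_le_div_right hle _

end Dataset

/-! ### One-step exponential moment bounds. -/

section Moments

variable {α : Type*} [MeasurableSpace α] (ν : Measure α) [IsProbabilityMeasure ν]

/-- Since `exp (-u) ≤ 1 - u/2` on `[0, 1]`, half the mean is controlled multiplicatively. For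
squared residuals this yields a deviation free of the number of rounds. -/
lemma lintegral_exp_half_integral_sub_le_one {f : α → ℝ} (hf : Measurable f) {M : ℝ} (hM : 0 < M)
    (h0 : ∀ a, 0 ≤ f a) (h1 : ∀ a, f a ≤ M) :
    ∫⁻ a, ENNReal.ofReal (Real.exp (((∫ b, f b ∂ν) / 2 - f a) / M)) ∂ν ≤ 1 := by
  have hint : Integrable f ν := integrable_of_abs_le hf (C := M) fun a => by
    rw [abs_of_nonneg (h0 a)]; exact h1 a
  set m := ∫ b, f b ∂ν
  have hpt : ∀ a, Real.exp ((m / 2 - f a) / M) ≤ Real.exp (m / 2 / M) * (1 - f a / M / 2) := by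
    intro a
    rw [sub_div, sub_eq_add_neg, Real.exp_add]
    refine mul_le_mul_of_nonneg_left ?_ (Real.exp_pos _).le
    have hu0 : 0 ≤ f a / M := div_nonneg (h0 a) hM.le
    have hu1 : f a / M ≤ 1 := (div_le_one hM).2 (h1 a)
    set u := f a / M
    rw [Real.exp_neg, inv_le_comm₀ (Real.exp_pos _) (by linarith)]
    refine le_trans ?_ (Real.add_one_le_exp u)
    -- Reduces to `(1 + u)(1 - u/2) ≥ 1` for `u` in `[0, 1]`.
    rw [inv_le_iff_one_le_mul₀ (by linarith)]
    nlinarith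
  have hi2 : Integrable (fun a => Real.exp (m / 2 / M) * (1 - f a / M / 2)) ν :=
    ((integrable_const _).sub ((hint.div_const M).div_const 2)).const_mul _
  calc ∫⁻ a, ENNReal.ofReal (Real.exp ((m / 2 - f a) / M)) ∂ν
      ≤ ∫⁻ a, ENNReal.ofReal (Real.exp (m / 2 / M) * (1 - f a / M / 2)) ∂ν :=
        lintegral_mono fun a => ENNReal.ofReal_le_ofReal (hpt a)
    _ = ENNReal.ofReal (∫ a, Real.exp (m / 2 / M) * (1 - f a / M / 2) ∂ν) :=
        (ofReal_integral_eq_lintegral_ofReal hi2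
          (ae_of_all _ fun a => (Real.exp_pos _).le.trans (hpt a))).symm
    _ = ENNReal.ofReal (Real.exp (m / 2 / M) * (1 - m / M / 2)) := by
        rw [integral_const_mul, integral_sub (integrable_const _)
          ((hint.div_const M).div_const 2), integral_div, integral_div]
        simp [m]
    _ ≤ 1 := by
        rw [ENNReal.ofReal_le_one]
        have h := Real.add_one_le_exp (-(m / 2 / M))
        have h2 : 1 - m / M / 2 ≤ Real.exp (-(m / 2 / M)) := by
          refine le_trans (le_of_eq ?_) h; ring
        calc _ ≤ Real.exp (m / 2 / M) * Real.exp (-(m / 2 / M)) :=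
              mul_le_mul_of_nonneg_left h2 (Real.exp_pos _).le
          _ = 1 := by rw [← Real.exp_add]; simp

/-- Hoeffding's lemma: a variable with values in `[-M, M]` has variance proxy `M ^ 2`. -/
lemma lintegral_exp_mul_integral_sub_le_one {f : α → ℝ} (hf : Measurable f) {M : ℝ} (hM : 0 ≤ M)
    (h : ∀ a, |f a| ≤ M) (l : ℝ) :
    ∫⁻ a, ENNReal.ofReal (Real.exp (l * ((∫ b, f b ∂ν) - f a) - l ^ 2 * M ^ 2 / 2)) ∂ν ≤ 1 := by
  have hs := hasSubgaussianMGF_of_mem_Icc (μ := ν) (X := f) (a := -M) (b := M) hf.aemeasurable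
    (ae_of_all _ fun a => abs_le.1 (h a))
  have hmgf := hs.mgf_le (-l)
  have hint := hs.integrable_exp_mul (-l)
  have hc : ((((‖M - -M‖₊ / 2) ^ 2 : NNReal)) : ℝ) = M ^ 2 := by
    push_cast
    rw [Real.norm_eq_abs, abs_of_nonneg (by linarith)]
    ring
  rw [hc] at hmgf
  have heq : ∀ a, Real.exp (l * ((∫ b, f b ∂ν) - f a) - l ^ 2 * M ^ 2 / 2)
      = Real.exp (-l * (f a - ∫ b, f b ∂ν)) * Real.exp (-(l ^ 2 * M ^ 2 / 2)) := by
    intro a; rw [← Real.exp_add]; congr 1; ring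
  simp_rw [heq]
  rw [← ofReal_integral_eq_lintegral_ofReal (hint.mul_const _)
    (ae_of_all _ fun a => by positivity), ENNReal.ofReal_le_one, integral_mul_const]
  have h2 : mgf (fun ω => f ω - ∫ b, f b ∂ν) ν (-l) ≤ Real.exp (l ^ 2 * M ^ 2 / 2) := by
    refine hmgf.trans (le_of_eq ?_); congr 1; ring
  calc _ ≤ Real.exp (l ^ 2 * M ^ 2 / 2) * Real.exp (-(l ^ 2 * M ^ 2 / 2)) :=
        mul_le_mul_of_nonneg_right h2 (Real.exp_pos _).le
    _ = 1 := by rw [← Real.exp_add]; simp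

end Moments

/-! ### Uniform bounds on log-ratios and residuals. -/

lemma prob_le_one (π : Kernel X Y) [IsMarkovKernel π] (x : X) (y : Y) : prob π x y ≤ 1 :=
  measureReal_le_one

lemma nonempty_responses (base : Kernel X Y) [IsMarkovKernel base] (x : X) : Nonempty Y :=
  nonempty_of_isProbabilityMeasure (base x)

lemma logRatio_sub_logRatio {π base : Kernel X Y} (hb : ∀ x y, 0 < prob base x y)
    (hπ : ∀ x y, 0 < prob π x y) {π' : Kernel X Y} (hπ' : ∀ x y, 0 < prob π' x y) (z : X × Y) :
    logRatio π base z - logRatio π' base z = logRatio π π' z := by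
  simp only [logRatio]
  rw [Real.log_div (hπ _ _).ne' (hb _ _).ne', Real.log_div (hπ' _ _).ne' (hb _ _).ne',
    Real.log_div (hπ _ _).ne' (hπ' _ _).ne']
  ring

lemma objective_eq (base : Kernel X Y) (β : ℝ) (r : X → Y → ℝ) (α : ℝ) {t : ℕ}
    (D : Fin t → X × Y × Y) (π : Kernel X Y) :
    objective base r β α D π = α * ∑ i, Real.log (prob π (D i).1 (D i).2.2)
      + ∑ i, residual base r β π (D i) ^ 2 := by
  unfold objective residual
  congr 1
  exact Finset.sum_congr rfl fun i _ => by ring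

lemma selfReward_mem {base : Kernel X Y} [IsMarkovKernel base] {R : ℝ}
    (hR : ∀ x y, 0 < prob base x y ∧ 1 + Real.log (1 / prob base x y) ≤ R)
    (x : X) (y : Y) : 1 - R ≤ selfReward base x y ∧ selfReward base x y ≤ 0 := by
  have h := (hR x y).2
  rw [one_div, Real.log_inv] at h
  exact ⟨by unfold selfReward; linarith,
    Real.log_nonpos (prob_nonneg _ _ _) (prob_le_one _ _ _)⟩

/-- `π` has full support and `|β log (π / base)| ≤ R`. -/
def BoundedRatio (base : Kernel X Y) (β R : ℝ) (π : Kernel X Y) : Prop :=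
  ∀ x y, 0 < prob π x y ∧ |β * Real.log (prob π x y / prob base x y)| ≤ R

lemma abs_logRatio_le {base : Kernel X Y} {β R : ℝ}
    (hb : ∀ x y, 0 < prob base x y) (hβ : 0 < β) {π π' : Kernel X Y}
    (hπ : BoundedRatio base β R π) (hπ' : BoundedRatio base β R π') (z : X × Y) :
    |logRatio π π' z| ≤ 2 * R / β := by
  have h1 : |β * logRatio π base z| ≤ R := (hπ z.1 z.2).2
  have h2 : |β * logRatio π' base z| ≤ R := (hπ' z.1 z.2).2
  have h3 : ∀ u : ℝ, β * |u| = |β * u| := fun u => by rw [abs_mul, abs_of_pos hβ]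
  rw [← logRatio_sub_logRatio hb (fun x y => (hπ x y).1) (fun x y => (hπ' x y).1),
    le_div_iff₀ hβ, mul_comm, h3, mul_sub]
  rw [abs_le] at *
  constructor <;> linarith

lemma abs_residual_le {base : Kernel X Y} [IsMarkovKernel base] {β R : ℝ}
    (hR : ∀ x y, 0 < prob base x y ∧ 1 + Real.log (1 / prob base x y) ≤ R)
    {π : Kernel X Y} (hπ : BoundedRatio base β R π) (z : X × Y × Y) :
    |residual base (selfReward base) β π z| ≤ 3 * R := by
  have h1 := abs_le.1 (hπ z.1 z.2.1).2
  have h2 := abs_le.1 (hπ z.1 z.2.2).2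
  have h3 := selfReward_mem hR z.1 z.2.1
  have h4 := selfReward_mem hR z.1 z.2.2
  rw [residual, abs_le]
  constructor <;> linarith

lemma residual_sq_le {base : Kernel X Y} [IsMarkovKernel base] {β R : ℝ}
    (hR : ∀ x y, 0 < prob base x y ∧ 1 + Real.log (1 / prob base x y) ≤ R)
    {π : Kernel X Y} (hπ : BoundedRatio base β R π) (z : X × Y × Y) :
    residual base (selfReward base) β π z ^ 2 ≤ 9 * R ^ 2 := by
  have h := sq_le_sq' (abs_le.1 (abs_residual_le hR hπ z)).1 (abs_le.1 (abs_residual_le hR hπ z)).2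
  linarith

/-! ### The power tilt as regularized optimum; optimism and regret. -/

section Tilt

variable [Fintype Y]

/-- `β` times the logarithm of the normalizing constant of the power tilt. -/
noncomputable def tiltLogNormalizer (base : Kernel X Y) (β : ℝ) (x : X) : ℝ :=
  β * Real.log (∑ y, prob base x y ^ (1 + β⁻¹))

variable {base tilt : Kernel X Y} [IsMarkovKernel base] {β : ℝ}

lemma mul_logRatio_tilt (hb : ∀ x y, 0 < prob base x y) (hβ : 0 < β)
    (ht : IsPowerTilt base β tilt) (z : X × Y) :
    β * logRatio tilt base z = selfReward base z.1 z.2 - tiltLogNormalizer base β z.1 := by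
  have := nonempty_responses base z.1
  have hZ : 0 < ∑ y, prob base z.1 y ^ (1 + β⁻¹) :=
    Finset.sum_pos (fun y _ => Real.rpow_pos_of_pos (hb _ _) _) Finset.univ_nonempty
  have hp := Real.rpow_pos_of_pos (hb z.1 z.2) (1 + β⁻¹)
  rw [logRatio, ht, Real.log_div (div_pos hp hZ).ne' (hb _ _).ne', Real.log_div hp.ne' hZ.ne',
    Real.log_rpow (hb _ _), tiltLogNormalizer, selfReward]
  field_simp
  ring

/-- The reward is `β log (tilt/base)` up to a normalizer depending on the prompt alone, which
cancels between the two responses. -/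
lemma residual_eq (hb : ∀ x y, 0 < prob base x y) (hβ : 0 < β) (ht : IsPowerTilt base β tilt)
    (htp : ∀ x y, 0 < prob tilt x y) {π : Kernel X Y} (hπ : ∀ x y, 0 < prob π x y)
    (z : X × Y × Y) :
    residual base (selfReward base) β π z
      = β * logRatio π tilt (z.1, z.2.1) - β * logRatio π tilt (z.1, z.2.2) := by
  have h1 := mul_logRatio_tilt hb hβ ht (z.1, z.2.1)
  have h2 := mul_logRatio_tilt hb hβ ht (z.1, z.2.2)
  rw [← logRatio_sub_logRatio hb hπ htp, ← logRatio_sub_logRatio hb hπ htp, mul_sub, mul_sub, h1,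
    h2]
  simp only [residual, logRatio]
  ring

/-- The residuals of `tilt` vanish, so its objective consists of the bonus term alone. -/
lemma optimism (hb : ∀ x y, 0 < prob base x y) (hβ : 0 < β) (ht : IsPowerTilt base β tilt)
    (htp : ∀ x y, 0 < prob tilt x y) {π : Kernel X Y} (hπ : ∀ x y, 0 < prob π x y) {α : ℝ} {t : ℕ}
    {D : Fin t → X × Y × Y}
    (h : objective base (selfReward base) β α D π ≤ objective base (selfReward base) β α D tilt) :
    α * ∑ i, logRatio π tilt ((D i).1, (D i).2.2)
      + ∑ i, residual base (selfReward base) β π (D i) ^ 2 ≤ 0 := by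
  rw [objective_eq, objective_eq] at h
  have h0 : ∑ i, residual base (selfReward base) β tilt (D i) ^ 2 = 0 := by
    refine Finset.sum_eq_zero fun i _ => ?_
    rw [residual_eq hb hβ ht htp htp]
    simp [logRatio, (htp _ _).ne']
  have h1 : ∑ i, logRatio π tilt ((D i).1, (D i).2.2)
      = ∑ i, Real.log (prob π (D i).1 (D i).2.2)
        - ∑ i, Real.log (prob tilt (D i).1 (D i).2.2) := by
    rw [← Finset.sum_sub_distrib]
    exact Finset.sum_congr rfl fun i _ => Real.log_div (hπ _ _).ne' (htp _ _).ne'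
  rw [h0] at h
  rw [h1, mul_sub]
  linarith

variable {R : ℝ}

variable [MeasurableSingletonClass Y]

lemma measurable_tiltLogNormalizer (base : Kernel X Y) (β : ℝ) :
    Measurable (tiltLogNormalizer base β) := by
  refine (Real.measurable_log.comp (Finset.measurable_sum _ fun y _ => ?_)).const_mul β
  have : Measurable fun x => prob base x y := (measurable_prob base).comp measurable_prodMk_right
  exact this.pow_const _

variable (μ : Measure X) [IsProbabilityMeasure μ]

/-- Gibbs' variational identity: the first term does not depend on `π`, and the last integral is the
KL divergence from `tilt`. Maximizing `J_β` is therefore minimizing that divergence. -/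
lemma regValue_eq (hR : ∀ x y, 0 < prob base x y ∧ 1 + Real.log (1 / prob base x y) ≤ R)
    (hβ : 0 < β) (ht : IsPowerTilt base β tilt) (htb : BoundedRatio base β R tilt)
    {π : Kernel X Y} [IsMarkovKernel π] (hπ : BoundedRatio base β R π) :
    regValue μ base (selfReward base) β π
      = ∫ x, tiltLogNormalizer base β x ∂μ - β * ∫ z, logRatio π tilt z ∂(μ ⊗ₘ π) := by
  have hb : ∀ x y, 0 < prob base x y := fun x y => (hR x y).1
  have hbase : BoundedRatio base β R base := fun x y => ⟨hb x y, by
    simpa [div_self (hb x y).ne'] using (abs_nonneg _).trans (hπ x y).2⟩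
  have hir : Integrable (fun z : X × Y => selfReward base z.1 z.2) (μ ⊗ₘ π) :=
    integrable_of_abs_le (measurable_selfReward base) (C := R) fun z => by
      have := selfReward_mem hR z.1 z.2
      rw [abs_le]; constructor <;> linarith
  have hib : Integrable (logRatio π base) (μ ⊗ₘ π) :=
    integrable_of_abs_le (measurable_logRatio _ _) (abs_logRatio_le hb hβ hπ hbase)
  have hit : Integrable (logRatio π tilt) (μ ⊗ₘ π) :=
    integrable_of_abs_le (measurable_logRatio _ _) (abs_logRatio_le hb hβ hπ htb)
  have hpt : ∀ z : X × Y, selfReward base z.1 z.2 - β * logRatio π base z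
      = tiltLogNormalizer base β z.1 - β * logRatio π tilt z := by
    intro z
    have h1 := mul_logRatio_tilt hb hβ ht z
    rw [← logRatio_sub_logRatio hb (fun x y => (hπ x y).1) (fun x y => (htb x y).1), mul_sub, h1]
    ring
  have hiZ : Integrable (fun z : X × Y => tiltLogNormalizer base β z.1) (μ ⊗ₘ π) := by
    have : (fun z : X × Y => tiltLogNormalizer base β z.1)
        = fun z => (selfReward base z.1 z.2 - β * logRatio π base z) + β * logRatio π tilt z := by
      funext z; rw [hpt]; ring
    rw [this]
    exact (hir.sub (hib.const_mul β)).add (hit.const_mul β)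
  have hfst : ∫ x, tiltLogNormalizer base β x ∂μ
      = ∫ z, tiltLogNormalizer base β z.1 ∂(μ ⊗ₘ π) := by
    conv_lhs => rw [← Measure.fst_compProd μ π, Measure.fst]
    exact integral_map measurable_fst.aemeasurable
      (measurable_tiltLogNormalizer base β).aestronglyMeasurable
  rw [regValue, toReal_klDiv_compProd μ π base hb, hfst, ← integral_const_mul,
    ← integral_const_mul, ← integral_sub hir (hib.const_mul β),
    ← integral_sub hiZ (hit.const_mul β)]
  exact integral_congr_ae (ae_of_all _ hpt)

/-- The regret of `π` splits into its residual on-policy and its log-likelihood excess under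
`base`. -/
lemma regret_eq (hR : ∀ x y, 0 < prob base x y ∧ 1 + Real.log (1 / prob base x y) ≤ R)
    (hβ : 0 < β) (ht : IsPowerTilt base β tilt) (htb : BoundedRatio base β R tilt)
    {π : Kernel X Y} [IsMarkovKernel π] (hπ : BoundedRatio base β R π) :
    β * ∫ z, logRatio π tilt z ∂(μ ⊗ₘ π)
      = ∫ z, residual base (selfReward base) β π z ∂(roundLaw μ base π)
        + β * ∫ z, logRatio π tilt z ∂(μ ⊗ₘ base) := by
  have hb : ∀ x y, 0 < prob base x y := fun x y => (hR x y).1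
  have hm := measurable_logRatio π tilt
  have hm1 : Measurable fun z : X × Y × Y => logRatio π tilt (z.1, z.2.1) :=
    hm.comp (by fun_prop)
  have hm2 : Measurable fun z : X × Y × Y => logRatio π tilt (z.1, z.2.2) :=
    hm.comp (by fun_prop)
  have hle := abs_logRatio_le hb hβ hπ htb
  have hi1 : Integrable (fun z : X × Y × Y => logRatio π tilt (z.1, z.2.1)) (roundLaw μ base π) :=
    integrable_of_abs_le hm1 fun z => hle _
  have hi2 : Integrable (fun z : X × Y × Y => logRatio π tilt (z.1, z.2.2)) (roundLaw μ base π) :=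
    integrable_of_abs_le hm2 fun z => hle _
  simp_rw [residual_eq hb hβ ht (fun x y => (htb x y).1) (fun x y => (hπ x y).1)]
  rw [integral_sub (hi1.const_mul β) (hi2.const_mul β), integral_const_mul, integral_const_mul,
    integral_roundLaw_fst μ base π hm, integral_roundLaw_snd μ base π hm]
  ring

end Tilt

/-! ### From small KL divergence to sharpening. -/

section Sharpening

variable [Fintype Y] [MeasurableSingletonClass Y]
  {base tilt : Kernel X Y} [IsMarkovKernel base] {β γ δ R : ℝ}

/-- Raising to the power `1 + 1/β` turns the margin into a factor `(1 + γ) ^ (1 + 1/β) ≥ 2 |Y| / δ`,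
because `log (1 + γ) ≥ γ/2` for `γ < 1`. Summing over at most `|Y|` responses leaves `δ/2`. -/
lemma tilt_compl_argmaxSet_le (hb : ∀ x y, 0 < prob base x y) (hβ : 0 < β)
    (hγ : γ ∈ Set.Ioo (0 : ℝ) 1) (hδ : 0 < δ) (ht : IsPowerTilt base β tilt) [IsMarkovKernel tilt]
    (hβγ : 2 * γ⁻¹ * Real.log (2 * Fintype.card Y / δ) ≤ β⁻¹) (x : X)
    (hx : ∀ y', y' ∉ argmaxSet base x → (1 + γ) * prob base x y' ≤ ⨆ y, prob base x y) :
    (tilt x).real (argmaxSet base x)ᶜ ≤ δ / 2 := by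
  classical
  have hne := nonempty_responses base x
  obtain ⟨y0, hy0⟩ := Finite.exists_max fun y => prob base x y
  have hsup : ⨆ y, prob base x y = prob base x y0 :=
    le_antisymm (ciSup_le hy0)
      (le_ciSup (f := fun y => prob base x y) (Set.finite_range _).bddAbove y0)
  have hK : (0 : ℝ) < Fintype.card Y := by exact_mod_cast Fintype.card_pos
  have hγ0 : 0 < γ := hγ.1
  have h1γ : 0 < 1 + γ := by linarith
  have hlog : γ / 2 ≤ Real.log (1 + γ) := by
    have h := Real.one_sub_inv_le_log_of_pos h1γ
    have : γ / 2 ≤ 1 - (1 + γ)⁻¹ := by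
      rw [← sub_nonneg]
      have : 1 - (1 + γ)⁻¹ - γ / 2 = γ * (1 - γ) / (2 * (1 + γ)) := by field_simp; ring
      rw [this]
      exact div_nonneg (mul_nonneg hγ0.le (by linarith [hγ.2])) (by linarith)
    linarith
  have hpoint : ∀ y, y ∉ argmaxSet base x → prob tilt x y ≤ δ / (2 * Fintype.card Y) := by
    intro y hy
    have hm := hx y hy
    rw [hsup] at hm
    have hy0pos := Real.rpow_pos_of_pos (hb x y0) (1 + β⁻¹)
    have hZ : prob base x y0 ^ (1 + β⁻¹) ≤ ∑ y', prob base x y' ^ (1 + β⁻¹) :=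
      Finset.single_le_sum (f := fun y' => prob base x y' ^ (1 + β⁻¹))
        (fun y' _ => (Real.rpow_pos_of_pos (hb x y') _).le) (Finset.mem_univ y0)
    have hexp : 0 ≤ 1 + β⁻¹ := by positivity
    have hpow := Real.rpow_le_rpow (mul_nonneg h1γ.le (prob_nonneg base x y)) hm hexp
    rw [Real.mul_rpow h1γ.le (prob_nonneg _ _ _)] at hpow
    have hbig : 2 * Fintype.card Y / δ ≤ (1 + γ) ^ (1 + β⁻¹) := by
      rw [Real.rpow_def_of_pos h1γ, ← Real.log_le_iff_le_exp (by positivity)]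
      have h2 : Real.log (2 * Fintype.card Y / δ) ≤ γ / 2 * β⁻¹ := by
        have := mul_le_mul_of_nonneg_left hβγ (by positivity : 0 ≤ γ / 2)
        refine le_trans (le_of_eq ?_) this
        field_simp
      have h3 : 0 < β⁻¹ := inv_pos.2 hβ
      nlinarith
    rw [ht, div_le_div_iff₀ (hy0pos.trans_le hZ) (by positivity)]
    have hq := (Real.rpow_pos_of_pos (hb x y) (1 + β⁻¹))
    rw [div_le_iff₀ hδ] at hbig
    calc prob base x y ^ (1 + β⁻¹) * (2 * Fintype.card Y)
        ≤ prob base x y ^ (1 + β⁻¹) * ((1 + γ) ^ (1 + β⁻¹) * δ) :=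
          mul_le_mul_of_nonneg_left hbig hq.le
      _ = δ * ((1 + γ) ^ (1 + β⁻¹) * prob base x y ^ (1 + β⁻¹)) := by ring
      _ ≤ δ * ∑ y', prob base x y' ^ (1 + β⁻¹) :=
          mul_le_mul_of_nonneg_left (hpow.trans hZ) hδ.le
  rw [real_eq_sum_prob]
  calc ∑ y, (if y ∈ (argmaxSet base x)ᶜ then prob tilt x y else 0)
      ≤ ∑ _y : Y, δ / (2 * Fintype.card Y) := Finset.sum_le_sum fun y _ => by
        split_ifs with h
        · exact hpoint y h
        · positivity
    _ = δ / 2 := by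
        rw [Finset.sum_const, Finset.card_univ, nsmul_eq_mul]
        field_simp

/-- A reverse Donsker–Varadhan bound with the test function `log 2` on `s`. -/
lemma log_two_mul_sub_le_sum {π : Kernel X Y} [IsMarkovKernel π] [IsMarkovKernel tilt]
    (hπ : ∀ x y, 0 < prob π x y) (ht : ∀ x y, 0 < prob tilt x y) (x : X) (s : Set Y) {c : ℝ}
    (hc : 0 < c) :
    Real.log c * (π x).real s - (c - 1) * (tilt x).real s
      ≤ ∑ y, prob π x y * logRatio π tilt (x, y) := by
  classical
  have hterm : ∀ y, Real.log c * (if y ∈ s then prob π x y else 0)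
      - (c - 1) * (if y ∈ s then prob tilt x y else 0) + prob π x y - prob tilt x y
      ≤ prob π x y * logRatio π tilt (x, y) := by
    intro y
    -- This is `1 - 1/u ≤ log u` at `u = π / (d tilt)`, used with `d = c` on `s` and `d = 1` off it.
    have key : ∀ d : ℝ, 0 < d → Real.log d * prob π x y + prob π x y - d * prob tilt x y
        ≤ prob π x y * logRatio π tilt (x, y) := by
      intro d hd
      have h := Real.one_sub_inv_le_log_of_pos (div_pos (hπ x y) (mul_pos hd (ht x y)))
      rw [Real.log_div (hπ x y).ne' (mul_pos hd (ht x y)).ne',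
        Real.log_mul hd.ne' (ht x y).ne', inv_div] at h
      simp only [logRatio]
      rw [Real.log_div (hπ x y).ne' (ht x y).ne']
      have h2 := mul_le_mul_of_nonneg_left h (hπ x y).le
      have h3 : prob π x y * (1 - d * prob tilt x y / prob π x y)
          = prob π x y - d * prob tilt x y := by
        have := (hπ x y).ne'
        field_simp
      nlinarith
    split_ifs with h
    · have := key c hc; linarith
    · have := key 1 one_pos; simp only [Real.log_one] at this; linarith
  have hsum := Finset.sum_le_sum fun y (_ : y ∈ Finset.univ) => hterm y
  simp only [Finset.sum_add_distrib, Finset.sum_sub_distrib, ← Finset.mul_sum, sum_prob] at hsum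
  rw [real_eq_sum_prob, real_eq_sum_prob]
  linarith

/-- The integral averages the conditional divergences `k x ≥ 0`, so `k x < δ/6` outside a set of
measure `ε`. At such a prompt the mass `π` gives to non-maximizers, times `log 2`, is at most `δ/6 +
δ/2 = 2δ/3`, and `2/3 < log 2`. -/
lemma isSharpened_of_integral_le (μ : Measure X) [IsProbabilityMeasure μ]
    (hb : ∀ x y, 0 < prob base x y) (hβ : 0 < β) (hγ : γ ∈ Set.Ioo (0 : ℝ) 1) (hδ : 0 < δ)
    (ht : IsPowerTilt base β tilt) [IsMarkovKernel tilt] (htb : BoundedRatio base β R tilt)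
    (hβγ : 2 * γ⁻¹ * Real.log (2 * Fintype.card Y / δ) ≤ β⁻¹) (hmargin : MarginCondition μ base γ)
    {π : Kernel X Y} [IsMarkovKernel π] (hπ : BoundedRatio base β R π) {ε : ℝ}
    (h : ∫ z, logRatio π tilt z ∂(μ ⊗ₘ π) ≤ ε * δ / 6) :
    IsSharpened μ base π ε δ := by
  have hint : Integrable (logRatio π tilt) (μ ⊗ₘ π) :=
    integrable_of_abs_le (measurable_logRatio _ _) (abs_logRatio_le hb hβ hπ htb)
  set k : X → ℝ := fun x => ∑ y, prob π x y * logRatio π tilt (x, y)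
  have hk : ∫ z, logRatio π tilt z ∂(μ ⊗ₘ π) = ∫ x, k x ∂μ := by
    rw [Measure.integral_compProd hint]
    refine integral_congr_ae (ae_of_all _ fun x => ?_)
    simp only
    rw [integral_fintype Integrable.of_finite]
    rfl
  have hkm : Measurable k := Finset.measurable_sum _ fun y _ =>
    ((measurable_prob π).comp measurable_prodMk_right).mul
      ((measurable_logRatio π tilt).comp measurable_prodMk_right)
  have hki : Integrable k μ := by
    refine hint.integral_compProd.congr (ae_of_all _ fun x => ?_)
    simp only
    rw [integral_fintype Integrable.of_finite]
    rfl
  have hk0 : ∀ x, 0 ≤ k x := fun x => by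
    simpa using log_two_mul_sub_le_sum (fun x y => (hπ x y).1) (fun x y => (htb x y).1) x ∅ one_pos
  have hmk := mul_meas_ge_le_integral_of_nonneg (ae_of_all μ hk0) hki (δ / 6)
  have hbad : μ.real {x | δ / 6 ≤ k x} ≤ ε := by
    rw [← hk] at hmk
    have h1 : δ / 6 * μ.real {x | δ / 6 ≤ k x} ≤ ε * δ / 6 := hmk.trans h
    by_contra hcon
    push Not at hcon
    nlinarith
  have hset : MeasurableSet {x | δ / 6 ≤ k x} := measurableSet_le measurable_const hkm
  have hgood := probReal_compl_eq_one_sub (μ := μ) hset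
  refine le_trans (by linarith : 1 - ε ≤ μ.real {x | δ / 6 ≤ k x}ᶜ) ?_
  refine ENNReal.toReal_mono (measure_ne_top _ _) (measure_mono_ae ?_)
  filter_upwards [hmargin] with x hx hxk
  have hxk : k x < δ / 6 := not_le.1 hxk
  have h1 := tilt_compl_argmaxSet_le hb hβ hγ hδ ht hβγ x hx
  have h2 := log_two_mul_sub_le_sum (fun x y => (hπ x y).1) (fun x y => (htb x y).1) x
    (argmaxSet base x)ᶜ two_pos
  have h3 := probReal_compl_eq_one_sub (μ := π x) (Set.toFinite (argmaxSet base x)).measurableSet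
  have hl := Real.log_two_gt_d9
  change 1 - δ ≤ (π x).real (argmaxSet base x)
  by_contra hcon
  push Not at hcon
  have h4 : δ < (π x).real (argmaxSet base x)ᶜ := by linarith
  change _ ≤ k x at h2
  nlinarith

end Sharpening

/-! ### Concentration for a fixed comparison model. -/

section Concentration

variable [Fintype Y] [MeasurableSingletonClass Y]
  (μ : Measure X) [IsProbabilityMeasure μ] (base : Kernel X Y)
  (A : Rule X Y) (tilt : Kernel X Y) (β R L : ℝ) (π : Kernel X Y)

/-- On the dataset `D` the residuals and the log-likelihood of `π` are close to their means. -/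
def Concentrates {n : ℕ} (D : Fin n → X × Y × Y) : Prop :=
  (∑ i : Fin n, ∫ z, residual base (selfReward base) β π z ^ 2
      ∂(roundLaw μ base (A.model (truncate i.isLt.le D)))
    ≤ 2 * ∑ i, residual base (selfReward base) β π (D i) ^ 2 + 18 * R ^ 2 * L) ∧
  n * ∫ z, logRatio π tilt z ∂(μ ⊗ₘ base)
    ≤ ∑ i, logRatio π tilt ((D i).1, (D i).2.2) + 2 * R / β * Real.sqrt (2 * L * n)

variable [IsMarkovKernel base]

lemma measurable_integral_residual_sq (hA : ∀ t, IsMarkovKernel (A t)) (i : ℕ) :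
    Measurable fun D : Fin i → X × Y × Y => ∫ z, residual base (selfReward base) β π z ^ 2
      ∂(roundLaw μ base (A.model D)) := by
  have := isMarkovKernel_roundKernel μ base A hA i
  simp_rw [← roundKernel_apply μ base A hA]
  exact (((measurable_residual base (measurable_selfReward base) β π).pow_const
    2).stronglyMeasurable.integral_kernel).measurable

lemma measurableSet_concentrates (hA : ∀ t, IsMarkovKernel (A t)) (n : ℕ) :
    MeasurableSet {D : Fin n → X × Y × Y | Concentrates μ base A tilt β R L π D} := by
  have hres := measurable_residual base (measurable_selfReward base) β π
  have hlog : Measurable fun z : X × Y × Y => logRatio π tilt (z.1, z.2.2) :=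
    (measurable_logRatio π tilt).comp (by fun_prop)
  have h2 : MeasurableSet {D : Fin n → X × Y × Y | n * ∫ z, logRatio π tilt z ∂(μ ⊗ₘ base)
      ≤ ∑ i, logRatio π tilt ((D i).1, (D i).2.2) + 2 * R / β * Real.sqrt (2 * L * n)} :=
    measurableSet_le measurable_const
      ((Finset.measurable_sum _ fun i _ => hlog.comp (measurable_pi_apply i)).add_const _)
  have h1 : MeasurableSet {D : Fin n → X × Y × Y |
      ∑ i : Fin n, ∫ z, residual base (selfReward base) β π z ^ 2
        ∂(roundLaw μ base (A.model (truncate i.isLt.le D)))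
      ≤ 2 * ∑ i, residual base (selfReward base) β π (D i) ^ 2 + 18 * R ^ 2 * L} :=
    measurableSet_le
      (Finset.measurable_sum _ fun i _ =>
        (measurable_integral_residual_sq μ base A β π hA i).comp (measurable_truncate _))
      (((Finset.measurable_sum _ fun i _ =>
        (hres.comp (measurable_pi_apply i)).pow_const 2).const_mul 2).add_const _)
  exact h1.inter h2

variable {base tilt β R L π}

lemma datasetLaw_not_concentrates_le (hA : ∀ t, IsMarkovKernel (A t))
    (hR : ∀ x y, 0 < prob base x y ∧ 1 + Real.log (1 / prob base x y) ≤ R) (hβ : 0 < β)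
    (hR0 : 0 < R) (hL : 0 < L) (htb : BoundedRatio base β R tilt) (hπ : BoundedRatio base β R π)
    {n : ℕ} (hn : 1 ≤ n) :
    datasetLaw μ base A n {D | ¬ Concentrates μ base A tilt β R L π D}
      ≤ ENNReal.ofReal (2 * Real.exp (-L)) := by
  have hb : ∀ x y, 0 < prob base x y := fun x y => (hR x y).1
  have hres := measurable_residual base (measurable_selfReward base) β π
  have hlog : Measurable fun z : X × Y × Y => logRatio π tilt (z.1, z.2.2) :=
    (measurable_logRatio π tilt).comp (by fun_prop)
  have hprob : ∀ (i : ℕ) (D : Fin i → X × Y × Y), IsMarkovKernel (A.model D) := fun i D => by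
    have := hA i
    unfold Rule.model; infer_instance
  have hn0 : (0 : ℝ) < n := by exact_mod_cast hn
  set q := Real.sqrt (2 * L * n) with hq
  have hq0 : 0 < q := Real.sqrt_pos.2 (by positivity)
  have hq2 : q ^ 2 = 2 * L * n := Real.sq_sqrt (by positivity)
  set M := 2 * R / β with hM
  have hM0 : 0 < M := by positivity
  set b := ∫ z, logRatio π tilt z ∂(μ ⊗ₘ base) with hbdef
  -- The optimal Hoeffding parameter: it makes the variance term `n l² M² / 2` equal to `L`, and the
  -- deviation becomes `M q`.
  set l := q / (n * M) with hl
  have hl0 : 0 < l := by positivity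
  have tail1 := datasetLaw_tail_le μ base A hA
    (fun i D z => ((∫ z, residual base (selfReward base) β π z ^ 2
      ∂(roundLaw μ base (A.model D))) / 2 - residual base (selfReward base) β π z ^ 2)
        / (9 * R ^ 2))
    (fun i => (((measurable_integral_residual_sq μ base A β π hA i).comp measurable_fst).div_const
      2 |>.sub ((hres.comp measurable_snd).pow_const 2)).div_const _)
    (fun i D => by
      have := hprob i D
      rw [roundKernel_apply μ base A hA]
      exact lintegral_exp_half_integral_sub_le_one _ (hres.pow_const 2) (by positivity)
        (fun _ => sq_nonneg _) (residual_sq_le hR hπ)) n L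
  have tail2 := datasetLaw_tail_le μ base A hA
    (fun i D z => l * (b - logRatio π tilt (z.1, z.2.2)) - l ^ 2 * M ^ 2 / 2)
    (fun i => ((measurable_const.sub (hlog.comp measurable_snd)).const_mul l).sub_const _)
    (fun i D => by
      have := hprob i D
      rw [roundKernel_apply μ base A hA, hbdef,
        ← integral_roundLaw_snd μ base (A.model D) (measurable_logRatio π tilt)]
      exact lintegral_exp_mul_integral_sub_le_one _ hlog hM0.le
        (fun z => abs_logRatio_le hb hβ hπ htb _) l) n L
  rw [two_mul, ENNReal.ofReal_add (Real.exp_pos _).le (Real.exp_pos _).le]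
  refine le_trans (measure_mono ?_) ((measure_union_le _ _).trans (add_le_add tail1 tail2))
  intro D hD
  by_contra hcon
  simp only [Set.mem_union, Set.mem_ofPred_eq, not_or, not_le] at hcon
  refine hD ⟨?_, ?_⟩
  · have h := hcon.1
    rw [← Finset.sum_div, Finset.sum_sub_distrib, ← Finset.sum_div,
      div_lt_iff₀ (by positivity)] at h
    linarith
  · have h := hcon.2
    rw [Finset.sum_sub_distrib, ← Finset.mul_sum, Finset.sum_sub_distrib] at h
    simp only [Finset.sum_const, Finset.card_univ, Fintype.card_fin, nsmul_eq_mul] at h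
    have h1 : l * M * n = q := by rw [hl]; field_simp
    have h2 : n * (l ^ 2 * M ^ 2 / 2) = L := by
      have : n * (n * (l ^ 2 * M ^ 2 / 2)) = n * L := by
        calc _ = (l * M * n) ^ 2 / 2 := by ring
          _ = n * L := by rw [h1, hq2]; ring
      exact mul_left_cancel₀ hn0.ne' this
    rw [h2] at h
    have h3 : l * (M * q) = 2 * L := by
      have : n * (l * (M * q)) = n * (2 * L) := by
        calc _ = (l * M * n) * q := by ring
          _ = n * (2 * L) := by rw [h1, ← sq, hq2]; ring
      exact mul_left_cancel₀ hn0.ne' this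
    have h4 : l * (n * b - ∑ i, logRatio π tilt ((D i).1, (D i).2.2)) < l * (M * q) := by
      rw [h3]; linarith
    have h5 := lt_of_mul_lt_mul_left h4 hl0.le
    linarith

end Concentration

/-! ### One round: transfer through the net and optimism. -/

section Round

/-- The residuals differ by at most `2βη`, and `(a + b)² ≤ 2a² + 2b²`. -/
lemma residual_sq_le_of_abs_logRatio_le [Fintype Y] {base tilt : Kernel X Y}
    [IsMarkovKernel base] {β : ℝ} {π π' : Kernel X Y} (hb : ∀ x y, 0 < prob base x y) (hβ : 0 < β)
    (ht : IsPowerTilt base β tilt) (htp : ∀ x y, 0 < prob tilt x y)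
    (hπ : ∀ x y, 0 < prob π x y) (hπ' : ∀ x y, 0 < prob π' x y) {η : ℝ}
    (h : ∀ z, |logRatio π π' z| ≤ η) (z : X × Y × Y) :
    residual base (selfReward base) β π z ^ 2
      ≤ 2 * residual base (selfReward base) β π' z ^ 2 + 8 * β ^ 2 * η ^ 2 := by
  rw [residual_eq hb hβ ht htp hπ, residual_eq hb hβ ht htp hπ']
  have h1 := logRatio_sub_logRatio htp hπ hπ' (z.1, z.2.1)
  have h2 := logRatio_sub_logRatio htp hπ hπ' (z.1, z.2.2)
  set a := logRatio π tilt (z.1, z.2.1)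
  set b := logRatio π tilt (z.1, z.2.2)
  set a' := logRatio π' tilt (z.1, z.2.1)
  set b' := logRatio π' tilt (z.1, z.2.2)
  have h3 := abs_le.1 (h (z.1, z.2.1))
  have h4 := abs_le.1 (h (z.1, z.2.2))
  rw [← h1] at h3
  rw [← h2] at h4
  have h5 : ((a - a') - (b - b')) ^ 2 ≤ (2 * η) ^ 2 :=
    sq_le_sq' (by linarith) (by linarith)
  have h6 := mul_le_mul_of_nonneg_left h5 (sq_nonneg β)
  nlinarith [sq_nonneg (β * ((a - a') - (b - b')) - β * (a' - b'))]

variable [Fintype Y] [MeasurableSingletonClass Y]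
  (μ : Measure X) [IsProbabilityMeasure μ] {base tilt : Kernel X Y} [IsMarkovKernel base]
  (A : Rule X Y) {β R L : ℝ} {π π' : Kernel X Y}

/-- The consequence of optimism for a near-minimizer of the objective. -/
lemma sum_integral_residual_sq_le (hA : ∀ t, IsMarkovKernel (A t))
    (hR : ∀ x y, 0 < prob base x y ∧ 1 + Real.log (1 / prob base x y) ≤ R) (hβ : 0 < β)
    (ht : IsPowerTilt base β tilt) (htb : BoundedRatio base β R tilt)
    (hπ : BoundedRatio base β R π) (hπ' : BoundedRatio base β R π') {η : ℝ}
    (h : ∀ z, |logRatio π π' z| ≤ η) {α : ℝ} (hα : 0 < α) {n : ℕ} {D : Fin n → X × Y × Y}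
    (hc : Concentrates μ base A tilt β R L π' D)
    (hopt : objective base (selfReward base) β α D π ≤ objective base (selfReward base) β α D tilt)
    (hη : 40 * β ^ 2 * (n * η ^ 2) ≤ R ^ 2 * L) :
    0 ≤ 2 * R / β * Real.sqrt (2 * L * n) + 2 * η * n
        - n * ∫ z, logRatio π tilt z ∂(μ ⊗ₘ base) ∧
    ∑ i : Fin n, ∫ z, residual base (selfReward base) β π z ^ 2
      ∂(roundLaw μ base (A.model (truncate i.isLt.le D)))
    ≤ 8 * α * (2 * R / β * Real.sqrt (2 * L * n) + 2 * η * n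
        - n * ∫ z, logRatio π tilt z ∂(μ ⊗ₘ base)) + 37 * (R ^ 2 * L) := by
  have hb : ∀ x y, 0 < prob base x y := fun x y => (hR x y).1
  have htp : ∀ x y, 0 < prob tilt x y := fun x y => (htb x y).1
  have hp : ∀ x y, 0 < prob π x y := fun x y => (hπ x y).1
  have hp' : ∀ x y, 0 < prob π' x y := fun x y => (hπ' x y).1
  have hη0 : ∀ z, logRatio π tilt z - logRatio π' tilt z ≤ η := fun z => by
    rw [logRatio_sub_logRatio htp hp hp']; exact (abs_le.1 (h z)).2
  have hη1 : ∀ z, logRatio π' tilt z ≤ logRatio π tilt z + η := fun z => by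
    have := (abs_le.1 (h z)).1
    rw [← logRatio_sub_logRatio htp hp hp'] at this; linarith
  have h' : ∀ z, |logRatio π' π z| ≤ η := fun z => by
    rw [logRatio, ← inv_div, Real.log_inv, abs_neg]; exact h z
  have hi : Integrable (logRatio π tilt) (μ ⊗ₘ base) :=
    integrable_of_abs_le (measurable_logRatio _ _) (abs_logRatio_le hb hβ hπ htb)
  have hi' : Integrable (logRatio π' tilt) (μ ⊗ₘ base) :=
    integrable_of_abs_le (measurable_logRatio _ _) (abs_logRatio_le hb hβ hπ' htb)
  have hbb : ∫ z, logRatio π tilt z ∂(μ ⊗ₘ base)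
      ≤ ∫ z, logRatio π' tilt z ∂(μ ⊗ₘ base) + η := by
    have : ∫ z, logRatio π tilt z ∂(μ ⊗ₘ base) ≤ ∫ z, (logRatio π' tilt z + η) ∂(μ ⊗ₘ base) :=
      integral_mono hi (hi'.add (integrable_const _)) fun z => by
        have := hη0 z; simp only; linarith
    rw [integral_add hi' (integrable_const _)] at this
    simpa using this
  have hsum : ∑ i, logRatio π' tilt ((D i).1, (D i).2.2)
      ≤ ∑ i, logRatio π tilt ((D i).1, (D i).2.2) + n * η := by
    have := Finset.sum_le_sum fun i (_ : i ∈ Finset.univ) => hη1 ((D i).1, (D i).2.2)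
    rw [Finset.sum_add_distrib] at this
    simpa using this
  have hres : ∑ i, residual base (selfReward base) β π' (D i) ^ 2
      ≤ 2 * ∑ i, residual base (selfReward base) β π (D i) ^ 2 + n * (8 * β ^ 2 * η ^ 2) := by
    have := Finset.sum_le_sum fun i (_ : i ∈ Finset.univ) =>
      residual_sq_le_of_abs_logRatio_le hb hβ ht htp hp' hp h' (D i)
    rw [Finset.sum_add_distrib, ← Finset.mul_sum] at this
    simpa using this
  have hmr := measurable_residual base (measurable_selfReward base) β π
  have hmr' := measurable_residual base (measurable_selfReward base) β π'
  have hE : ∑ i : Fin n, ∫ z, residual base (selfReward base) β π z ^ 2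
        ∂(roundLaw μ base (A.model (truncate i.isLt.le D)))
      ≤ 2 * ∑ i : Fin n, ∫ z, residual base (selfReward base) β π' z ^ 2
        ∂(roundLaw μ base (A.model (truncate i.isLt.le D))) + n * (8 * β ^ 2 * η ^ 2) := by
    have hterm : ∀ i : Fin n, ∫ z, residual base (selfReward base) β π z ^ 2
        ∂(roundLaw μ base (A.model (truncate i.isLt.le D)))
      ≤ 2 * ∫ z, residual base (selfReward base) β π' z ^ 2
        ∂(roundLaw μ base (A.model (truncate i.isLt.le D))) + 8 * β ^ 2 * η ^ 2 := by
      intro i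
      have : IsMarkovKernel (A.model (truncate i.isLt.le D)) := by
        have := hA i
        unfold Rule.model; infer_instance
      have hint : ∀ {π₀ : Kernel X Y}, BoundedRatio base β R π₀ →
          Integrable (fun z => residual base (selfReward base) β π₀ z ^ 2)
            (roundLaw μ base (A.model (truncate i.isLt.le D))) := fun {π₀} h₀ =>
        integrable_of_abs_le
          ((measurable_residual base (measurable_selfReward base) β π₀).pow_const 2)
          (C := 9 * R ^ 2) fun z => by
            rw [abs_of_nonneg (sq_nonneg _)]; exact residual_sq_le hR h₀ z
      have := integral_mono (hint hπ) (((hint hπ').const_mul 2).add (integrable_const _))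
        fun z => residual_sq_le_of_abs_logRatio_le hb hβ ht htp hp hp' h z
      simp only [Pi.add_apply] at this
      rw [integral_add ((hint hπ').const_mul 2) (integrable_const _), integral_const_mul] at this
      simpa using this
    have := Finset.sum_le_sum fun i (_ : i ∈ Finset.univ) => hterm i
    rw [Finset.sum_add_distrib, ← Finset.mul_sum] at this
    simpa using this
  have hop := optimism hb hβ ht htp hp hopt
  obtain ⟨hc1, hc2⟩ := hc
  have hn0 : (0 : ℝ) ≤ n := n.cast_nonneg
  have hbn := mul_le_mul_of_nonneg_left hbb hn0
  -- The term `2ηn` pays for the net twice: in the population mean and in the empirical sum.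
  have hge : ∑ i, residual base (selfReward base) β π (D i) ^ 2
      ≤ α * (2 * R / β * Real.sqrt (2 * L * n) + 2 * η * n
        - n * ∫ z, logRatio π tilt z ∂(μ ⊗ₘ base)) := by
    have : -∑ i, logRatio π tilt ((D i).1, (D i).2.2)
        ≤ 2 * R / β * Real.sqrt (2 * L * n) + 2 * η * n
          - n * ∫ z, logRatio π tilt z ∂(μ ⊗ₘ base) := by linarith
    have := mul_le_mul_of_nonneg_left this hα.le
    linarith
  refine ⟨?_, ?_⟩
  · have h0 := (Finset.sum_nonneg fun i (_ : i ∈ Finset.univ) =>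
      sq_nonneg (residual base (selfReward base) β π (D i))).trans hge
    exact nonneg_of_mul_nonneg_right h0 hα
  -- Population to empirical through the net: the factor is `2 · 2 · 2 = 8`, the concentration error
  -- is `2 · 18 R² L`, and the net error `(8 + 32) n β² η²` is at most `R² L` by `hη`.
  · linarith

end Round

/-! ### Scalar inequalities and finiteness of the SEC. -/

/-- AM-GM separately on `√(s u)` and `√(s v)`; the free weight `κ` later makes `v / κ` cancel a term
of the regret. -/
lemma le_of_sq_le_mul_add {e s u v θ κ : ℝ} (h : e ^ 2 ≤ s * (u + v)) (hs : 0 ≤ s) (hu : 0 ≤ u)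
    (hv : 0 ≤ v) (hθ : 0 < θ) (hκ : 0 < κ) :
    e ≤ (s * θ + u / θ) / 2 + (s * κ + v / κ) / 2 := by
  have key : ∀ {a b : ℝ}, 0 ≤ a → 0 < b → s * a ≤ ((s * b + a / b) / 2) ^ 2 := by
    intro a b ha hb
    have h1 : (s * b) * (a / b) = s * a := by field_simp
    nlinarith [sq_nonneg (s * b - a / b)]
  have h1 := key hu hθ
  have h2 := key hv hκ
  have hA : 0 ≤ (s * θ + u / θ) / 2 := by positivity
  have hB : 0 ≤ (s * κ + v / κ) / 2 := by positivity
  refine (abs_le_of_sq_le_sq' (a := e) ?_ (add_nonneg hA hB)).2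
  nlinarith [mul_nonneg hA hB]

lemma sum_sqrt_div_le (T : ℕ) :
    ∑ j : Fin T, Real.sqrt ((j + 1 : ℕ) : ℝ) / ((j + 1 : ℕ) : ℝ) ≤ 2 * Real.sqrt T := by
  rw [Fin.sum_univ_eq_sum_range (fun j => Real.sqrt ((j + 1 : ℕ) : ℝ) / ((j + 1 : ℕ) : ℝ))]
  induction T with
  | zero => simp
  | succ T ih =>
    rw [Finset.sum_range_succ]
    have h0 := Real.sqrt_nonneg (T : ℝ)
    have h1 : 0 < Real.sqrt ((T + 1 : ℕ) : ℝ) := Real.sqrt_pos.2 (by positivity)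
    have h2 := Real.sq_sqrt (Nat.cast_nonneg (α := ℝ) T)
    have h3 := Real.sq_sqrt (Nat.cast_nonneg (α := ℝ) (T + 1))
    rw [Real.sqrt_div_self']
    have h4 : 1 / Real.sqrt ((T + 1 : ℕ) : ℝ)
        ≤ 2 * Real.sqrt ((T + 1 : ℕ) : ℝ) - 2 * Real.sqrt T := by
      rw [div_le_iff₀ h1]
      push_cast at h3 ⊢
      nlinarith [sq_nonneg (Real.sqrt ((T : ℝ) + 1) - Real.sqrt T)]
    linarith

lemma sum_Iio_eq_sum_fin {T : ℕ} (j : Fin T) (f : Fin T → ℝ) :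
    ∑ i ∈ Finset.Iio j, f i = ∑ k : Fin j, f (Fin.castLE j.isLt.le k) := by
  refine (Finset.sum_nbij (Fin.castLE j.isLt.le) (fun k _ => ?_) (fun a _ b _ h => ?_)
    (fun i hi => ?_) fun _ _ => rfl).symm
  · exact Finset.mem_Iio.2 (Fin.lt_def.2 k.isLt)
  · exact Fin.castLE_injective _ h
  · exact ⟨⟨i, Fin.lt_def.1 (Finset.mem_Iio.1 hi)⟩, Finset.mem_coe.2 (Finset.mem_univ _), rfl⟩

variable {X Y : Type*} [MeasurableSpace X] [MeasurableSpace Y]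

/-- A real supremum dominates its members only over a bounded set; each summand is at most `(3R)² /
R² = 9`. -/
lemma secSum_le_SEC (μ : Measure X) [IsProbabilityMeasure μ] {base : Kernel X Y}
    [IsMarkovKernel base] {β R : ℝ} {T : ℕ} {models : Set (Kernel X Y)}
    (hm : ∀ π ∈ models, IsMarkovKernel π)
    (hR : ∀ x y, 0 < prob base x y ∧ 1 + Real.log (1 / prob base x y) ≤ R) (hR0 : 0 < R)
    (hbd : BoundedDensityRatios base models β R) (p : Fin T → models) :
    secSum μ base (selfReward base) β (R ^ 2) (fun t => (p t : Kernel X Y))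
      ≤ SEC μ models (selfReward base) T β (R ^ 2) base := by
  refine le_ciSup (f := fun p : Fin T → models =>
    secSum μ base (selfReward base) β (R ^ 2) (fun t => (p t : Kernel X Y))) ⟨T * 9, ?_⟩ p
  rintro _ ⟨p, rfl⟩
  have hterm : ∀ t : Fin T, (∫ z, residual base (selfReward base) β (p t) z
      ∂(roundLaw μ base (p t))) ^ 2 / max (R ^ 2) (∑ i ∈ Finset.Iio t,
        ∫ z, residual base (selfReward base) β (p t) z ^ 2 ∂(roundLaw μ base (p i))) ≤ 9 := by
    intro t
    have := hm _ (p t).2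
    have hR2 : 0 < R ^ 2 := by positivity
    rw [div_le_iff₀ (lt_max_of_lt_left hR2)]
    have h1 : |∫ z, residual base (selfReward base) β (p t) z ∂(roundLaw μ base (p t))|
        ≤ 3 * R := by
      simpa using norm_integral_le_of_norm_le_const (μ := roundLaw μ base (p t))
        (f := residual base (selfReward base) β (p t)) (C := 3 * R)
        (ae_of_all _ fun z => abs_residual_le hR (hbd _ (p t).2) z)
    have h2 := sq_le_sq' (abs_le.1 h1).1 (abs_le.1 h1).2
    have h3 := le_max_left (R ^ 2) (∑ i ∈ Finset.Iio t,
        ∫ z, residual base (selfReward base) β (p t) z ^ 2 ∂(roundLaw μ base (p i)))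
    nlinarith
  calc _ ≤ ∑ _t : Fin T, (9 : ℝ) := Finset.sum_le_sum fun t _ => hterm t
    _ = T * 9 := by simp

/-! ### Cumulative regret via the SEC. -/

section Regret

variable [Fintype Y] [MeasurableSingletonClass Y]
  (μ : Measure X) [IsProbabilityMeasure μ] {base tilt : Kernel X Y} [IsMarkovKernel base]
  {A : Rule X Y} {β R L S α η : ℝ} {T : ℕ}

/-- The cumulative regret of an optimistic run on a concentrated dataset. -/
lemma sum_regret_le (hA : ∀ t, IsMarkovKernel (A t))
    (hR : ∀ x y, 0 < prob base x y ∧ 1 + Real.log (1 / prob base x y) ≤ R) (hβ : 0 < β)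
    (ht : IsPowerTilt base β tilt) (htb : BoundedRatio base β R tilt) (hR1 : 1 ≤ R)
    (hL : 1 / 2 ≤ L) (hS : 1 ≤ S) (hα : 0 < α)
    (hαS : α * (S * T) ≤ 3 / 2 * β * R * Real.sqrt (L * S * T))
    (hη : 40 * β ^ 2 * (T * η ^ 2) ≤ R ^ 2 * L) (D : Fin T → X × Y × Y)
    (p : Fin T → Kernel X Y) (hp : ∀ j : Fin T, p j = A.model (truncate (n := j + 1) j.isLt D))
    (hbd : ∀ j, BoundedRatio base β R (p j))
    (hsec : secSum μ base (selfReward base) β (R ^ 2) p ≤ S)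
    (hnet : ∀ j : Fin T, ∃ π', BoundedRatio base β R π' ∧ (∀ z, |logRatio (p j) π' z| ≤ η) ∧
      Concentrates μ base A tilt β R L π' (truncate (n := j + 1) j.isLt D))
    (hopt : ∀ j : Fin T,
      objective base (selfReward base) β α (truncate (n := j + 1) j.isLt D) (p j)
        ≤ objective base (selfReward base) β α (truncate (n := j + 1) j.isLt D) tilt) :
    ∑ j, β * ∫ z, logRatio (p j) tilt z ∂(μ ⊗ₘ p j)
      ≤ 16 * (R * Real.sqrt (L * S * T)) + 2 * η * β * T := by
  rcases Nat.eq_zero_or_pos T with rfl | hT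
  · simp
  have hT0 : (0 : ℝ) < T := by exact_mod_cast hT
  have hS0 : 0 < S := by linarith
  have hL0 : 0 < L := by linarith
  have hR0 : 0 < R := by linarith
  set w := Real.sqrt (L * S * T) with hw
  have hw0 : 0 < w := Real.sqrt_pos.2 (by positivity)
  have hw2 : w ^ 2 = L * S * T := Real.sq_sqrt (by positivity)
  set e : Fin T → ℝ := fun j => ∫ z, residual base (selfReward base) β (p j) z
    ∂(roundLaw μ base (p j)) with he
  set m : Fin T → ℝ := fun j => max (R ^ 2) (∑ i ∈ Finset.Iio j,
    ∫ z, residual base (selfReward base) β (p j) z ^ 2 ∂(roundLaw μ base (p i))) with hm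
  have hm0 : ∀ j, 0 < m j := fun j => lt_max_of_lt_left (by positivity)
  set s : Fin T → ℝ := fun j => e j ^ 2 / m j with hs
  have hs0 : ∀ j, 0 ≤ s j := fun j => div_nonneg (sq_nonneg _) (hm0 j).le
  have hsS : ∑ j, s j ≤ S := hsec
  set q : Fin T → ℝ := fun j => Real.sqrt ((j + 1 : ℕ) : ℝ) / ((j + 1 : ℕ) : ℝ) with hq
  have hround : ∀ j, β * ∫ z, logRatio (p j) tilt z ∂(μ ⊗ₘ p j)
      ≤ s j * (3 * R * w / S + 2 * α * T / β) + 39 * R * L * S / (12 * w)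
        + 2 * R * Real.sqrt (2 * L) * q j + 2 * η * β := by
    intro j
    obtain ⟨π', hb', hnear, hconc⟩ := hnet j
    have hMark : IsMarkovKernel (p j) := by
      rw [hp]
      have := hA (j + 1)
      unfold Rule.model; infer_instance
    have hn0 : (0 : ℝ) < ((j + 1 : ℕ) : ℝ) := by positivity
    have hnT : ((j + 1 : ℕ) : ℝ) ≤ T := by exact_mod_cast j.isLt
    set n : ℝ := ((j + 1 : ℕ) : ℝ) with hn
    have hηn : 40 * β ^ 2 * (n * η ^ 2) ≤ R ^ 2 * L := by
      refine le_trans ?_ hη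
      gcongr
    obtain ⟨hX, hsum⟩ := sum_integral_residual_sq_le μ A hA hR hβ ht htb (hbd j) hb' hnear hα
      hconc (hopt j) hηn
    set b := ∫ z, logRatio (p j) tilt z ∂(μ ⊗ₘ base) with hb
    set x := 2 * R / β * Real.sqrt (2 * L * n) + 2 * η * n - n * b with hx
    have ha : ∑ i ∈ Finset.Iio j,
        ∫ z, residual base (selfReward base) β (p j) z ^ 2 ∂(roundLaw μ base (p i))
        ≤ 8 * α * x + 37 * (R ^ 2 * L) := by
      refine le_trans ?_ hsum
      -- With rounds counted from zero, `p k` generates round `k + 1`, while round `0` comes from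
      -- the initial model. The nonnegative contribution of round `0` is dropped.
      rw [sum_Iio_eq_sum_fin, Fin.sum_univ_succ]
      refine le_add_of_nonneg_of_le (integral_nonneg fun z => sq_nonneg _) (le_of_eq ?_)
      refine Finset.sum_congr rfl fun k _ => ?_
      rw [hp]
      rfl
    have hmle : m j ≤ 39 * (R ^ 2 * L) + 8 * α * x := by
      have h0 : 0 ≤ 8 * α * x := by positivity
      have h1 : R ^ 2 ≤ 2 * (R ^ 2 * L) := by nlinarith [sq_nonneg R]
      refine max_le ?_ ?_
      · nlinarith [sq_nonneg R]
      · nlinarith [sq_nonneg R]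
    have hes : e j ^ 2 ≤ s j * (39 * (R ^ 2 * L) + 8 * α * x) := by
      calc e j ^ 2 = s j * m j := by rw [hs]; field_simp [(hm0 j).ne']
        _ ≤ _ := mul_le_mul_of_nonneg_left hmle (hs0 j)
    -- This `κ` turns half of `8αx/κ` into `βx/n`, which contains `-βb` and so cancels the
    -- off-policy part of the regret. The weight `θ` balances the remaining terms after summation,
    -- as the `s j` sum to at most `S`.
    have hfin := le_of_sq_le_mul_add (θ := 6 * R * w / S) (κ := 4 * α * n / β) hes (hs0 j)
      (by positivity) (by positivity) (by positivity) (by positivity)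
    rw [regret_eq μ hR hβ ht htb (hbd j)]
    change e j + β * b ≤ _
    have h1 : 39 * (R ^ 2 * L) / (6 * R * w / S) / 2 = 39 * R * L * S / (12 * w) := by
      field_simp; ring
    have h2 : 8 * α * x / (4 * α * n / β) / 2
        = 2 * R * Real.sqrt (2 * L) * q j + 2 * η * β - β * b := by
      rw [hx, hq, Real.sqrt_mul (by positivity)]
      simp only [← hn]
      field_simp
      ring
    have h3 : s j * (4 * α * n / β) / 2 ≤ s j * (2 * α * T / β) := by
      rw [mul_div_assoc]
      refine mul_le_mul_of_nonneg_left ?_ (hs0 j)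
      calc 4 * α * n / β / 2 = 2 * α / β * n := by ring
        _ ≤ 2 * α / β * T := mul_le_mul_of_nonneg_left hnT (by positivity)
        _ = 2 * α * T / β := by ring
    have h4 : s j * (6 * R * w / S) / 2 = s j * (3 * R * w / S) := by ring
    linarith
  refine (Finset.sum_le_sum fun j _ => hround j).trans ?_
  rw [Finset.sum_add_distrib, Finset.sum_add_distrib, Finset.sum_add_distrib, ← Finset.sum_mul,
    ← Finset.mul_sum]
  simp only [Finset.sum_const, Finset.card_univ, Fintype.card_fin, nsmul_eq_mul]
  have hq2 : ∑ j, q j ≤ 2 * Real.sqrt T := sum_sqrt_div_le T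
  have h1 : (∑ j, s j) * (3 * R * w / S + 2 * α * T / β) ≤ 6 * (R * w) := by
    calc (∑ j, s j) * (3 * R * w / S + 2 * α * T / β)
        ≤ S * (3 * R * w / S + 2 * α * T / β) :=
          mul_le_mul_of_nonneg_right hsS (by positivity)
      _ = 3 * (R * w) + 2 * (α * (S * T)) / β := by field_simp
      _ ≤ 3 * (R * w) + 2 * (3 / 2 * β * R * w) / β := by gcongr
      _ = 6 * (R * w) := by field_simp; ring
  have h2 : T * (39 * R * L * S / (12 * w)) ≤ 4 * (R * w) := by
    have : T * (39 * R * L * S / (12 * w)) = 39 / 12 * (R * w) := by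
      have : L * S * T = w * w := by rw [← hw2, sq]
      field_simp
      linear_combination this
    rw [this]
    have : 0 < R * w := by positivity
    linarith
  have h3 : 2 * R * Real.sqrt (2 * L) * ∑ j, q j ≤ 6 * (R * w) := by
    have hsq : Real.sqrt (2 * L) * Real.sqrt T ≤ 3 / 2 * w := by
      rw [← Real.sqrt_mul (by positivity)]
      refine Real.sqrt_le_iff.2 ⟨by positivity, ?_⟩
      rw [mul_pow, hw2]
      have : L * T * 1 ≤ L * T * S := mul_le_mul_of_nonneg_left hS (by positivity)
      nlinarith [mul_pos hL0 hT0]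
    calc 2 * R * Real.sqrt (2 * L) * ∑ j, q j
        ≤ 2 * R * Real.sqrt (2 * L) * (2 * Real.sqrt T) :=
          mul_le_mul_of_nonneg_left hq2 (by positivity)
      _ = 4 * R * (Real.sqrt (2 * L) * Real.sqrt T) := by ring
      _ ≤ 4 * R * (3 / 2 * w) := mul_le_mul_of_nonneg_left hsq (by positivity)
      _ = 6 * (R * w) := by ring
  -- The three main contributions are `6 + 4 + 6 = 16` times `R w`.
  linarith

end Regret

/-! ### The high-probability event. -/

section Events

variable [Fintype Y] [MeasurableSingletonClass Y]
  (μ : Measure X) [IsProbabilityMeasure μ] {base tilt : Kernel X Y} [IsMarkovKernel base]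
  {A : Rule X Y} {β R L : ℝ} {T N : ℕ}

/-- Selected models depend on the data, so concentration is required of every net element after
every round. The union bound costs `N T` events of probability at most `2 exp (-L)`. -/
lemma exists_measurableSet_concentrates (hA : ∀ t, IsMarkovKernel (A t))
    (hR : ∀ x y, 0 < prob base x y ∧ 1 + Real.log (1 / prob base x y) ≤ R) (hβ : 0 < β)
    (hR0 : 0 < R) (hL : 0 < L) (htb : BoundedRatio base β R tilt) {Ψ : Finset (Kernel X Y)}
    (hΨ : ∀ π ∈ Ψ, BoundedRatio base β R π) (hN : Ψ.card ≤ N) {ρ : ℝ}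
    (hρ : 2 * N * T * Real.exp (-L) ≤ ρ) :
    ∃ G : Set (Fin T → X × Y × Y), MeasurableSet G ∧ 1 - ρ ≤ (datasetLaw μ base A T).real G ∧
      ∀ D ∈ G, ∀ π ∈ Ψ, ∀ j : Fin T,
        Concentrates μ base A tilt β R L π (truncate (n := j + 1) j.isLt D) := by
  have := isProbabilityMeasure_datasetLaw μ base A hA T
  set bad : Set (Fin T → X × Y × Y) := ⋃ j ∈ (Finset.univ : Finset (Fin T)), ⋃ π ∈ Ψ,
    truncate (n := j + 1) j.isLt ⁻¹'
      {D : Fin (j + 1) → X × Y × Y | ¬ Concentrates μ base A tilt β R L π D} with hbad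
  have hms : ∀ (j : Fin T) (π : Kernel X Y), MeasurableSet
      {D : Fin (j + 1) → X × Y × Y | ¬ Concentrates μ base A tilt β R L π D} := fun j π =>
    (measurableSet_concentrates μ base A tilt β R L π hA (j + 1)).compl
  have hmeas : MeasurableSet bad := Finset.measurableSet_biUnion _ fun j _ =>
    Finset.measurableSet_biUnion _ fun π _ => measurable_truncate _ (hms j π)
  have hle : datasetLaw μ base A T bad ≤ ENNReal.ofReal ρ := by
    calc datasetLaw μ base A T bad
        ≤ ∑ j : Fin T, ∑ π ∈ Ψ, datasetLaw μ base A T (truncate (n := j + 1) j.isLt ⁻¹'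
            {D : Fin (j + 1) → X × Y × Y | ¬ Concentrates μ base A tilt β R L π D}) :=
          (measure_biUnion_finset_le _ _).trans
            (Finset.sum_le_sum fun j _ => measure_biUnion_finset_le _ _)
      _ ≤ ∑ _j : Fin T, ∑ _π ∈ Ψ, ENNReal.ofReal (2 * Real.exp (-L)) := by
          refine Finset.sum_le_sum fun j _ => Finset.sum_le_sum fun π hπ => ?_
          rw [← Measure.map_apply (measurable_truncate _) (hms j π),
            map_truncate_datasetLaw μ base A hA]
          exact datasetLaw_not_concentrates_le μ A hA hR hβ hR0 hL htb (hΨ π hπ) j.val.succ_pos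
      _ = ENNReal.ofReal (T * (Ψ.card * (2 * Real.exp (-L)))) := by
          simp only [Finset.sum_const, Finset.card_univ, Fintype.card_fin, nsmul_eq_mul]
          rw [ENNReal.ofReal_mul (Nat.cast_nonneg _), ENNReal.ofReal_mul (Nat.cast_nonneg _),
            ENNReal.ofReal_natCast, ENNReal.ofReal_natCast]
      _ ≤ ENNReal.ofReal ρ := by
          refine ENNReal.ofReal_le_ofReal (le_trans ?_ hρ)
          have : (Ψ.card : ℝ) ≤ N := by exact_mod_cast hN
          calc (T : ℝ) * (Ψ.card * (2 * Real.exp (-L))) ≤ T * (N * (2 * Real.exp (-L))) := by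
                gcongr
            _ = _ := by ring
  have hρ0 : 0 ≤ ρ := le_trans (by positivity) hρ
  refine ⟨badᶜ, hmeas.compl, ?_, fun D hD π hπ j => ?_⟩
  · rw [probReal_compl_eq_one_sub hmeas]
    have := ENNReal.toReal_mono ENNReal.ofReal_ne_top hle
    rw [ENNReal.toReal_ofReal hρ0] at this
    change (datasetLaw μ base A T).real bad ≤ ρ at this
    linarith
  · by_contra hcon
    exact hD (Set.mem_biUnion (Finset.mem_coe.2 (Finset.mem_univ j))
      (Set.mem_biUnion (Finset.mem_coe.2 hπ) hcon))

end Events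

lemma exists_net_card_le {models : Set (Kernel X Y)} {η : ℝ} {N : ℕ}
    (h : coveringNumber models η = N) :
    ∃ Ψ : Finset (Kernel X Y), IsNet models Ψ η ∧ Ψ.card ≤ N := by
  have hlt : coveringNumber models η < (N + 1 : ℕ) := by
    rw [h]; exact_mod_cast N.lt_succ_self
  simp only [coveringNumber, iInf_lt_iff] at hlt
  obtain ⟨Ψ, hΨ, hcard⟩ := hlt
  have hfin : Ψ.Finite := Set.encard_lt_top_iff.1 (hcard.trans (ENat.natCast_lt_top _))
  refine ⟨hfin.toFinset, by simpa using hΨ, ?_⟩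
  rw [hfin.encard_eq_coe_toFinset_card] at hcard
  exact Nat.lt_succ_iff.1 (by exact_mod_cast hcard)

/-! ### Numerical consequences of the parameter choices. -/

section Rates

/-- Bootstrapping: the crude bound `1 + 2 log t ≤ 4 √t` first gives `√t ≤ 4ag`, which reinserted
bounds `log t` by `2 log (4a) + 2 log g`. -/
lemma le_mul_max_one_log {g t a : ℝ} (hg : 0 < g) (ht : 1 ≤ t) (ha : 1 ≤ a)
    (h : t ≤ a * g * (1 + 2 * Real.log t)) :
    t ≤ a * (5 + 4 * Real.log (4 * a)) * (g * max 1 (Real.log g)) := by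
  have ht0 : 0 < t := by linarith
  have hs0 : 0 < Real.sqrt t := Real.sqrt_pos.2 ht0
  have hs2 : Real.sqrt t ^ 2 = t := Real.sq_sqrt ht0.le
  have hlogs : Real.log t = 2 * Real.log (Real.sqrt t) := by
    rw [Real.log_sqrt ht0.le]; ring
  have h1 : 1 + 2 * Real.log t ≤ 4 * Real.sqrt t := by
    have := Real.log_le_sub_one_of_pos hs0
    rw [hlogs]; linarith
  have hag : 0 < a * g := by positivity
  have h2 : Real.sqrt t ≤ 4 * a * g := by
    have h3 : t ≤ a * g * (4 * Real.sqrt t) := h.trans (mul_le_mul_of_nonneg_left h1 hag.le)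
    nlinarith
  have h3 : Real.log t ≤ 2 * Real.log (4 * a) + 2 * Real.log g := by
    rw [hlogs, ← mul_add, ← Real.log_mul (by positivity) hg.ne']
    have := Real.log_le_log hs0 h2
    linarith
  have h4 : 0 ≤ Real.log (4 * a) := Real.log_nonneg (by linarith)
  have h5 : 1 + 2 * Real.log t ≤ (5 + 4 * Real.log (4 * a)) * max 1 (Real.log g) := by
    have h6 := le_max_left 1 (Real.log g)
    have h7 := le_max_right 1 (Real.log g)
    nlinarith
  calc t ≤ a * g * (1 + 2 * Real.log t) := h
    _ ≤ a * g * ((5 + 4 * Real.log (4 * a)) * max 1 (Real.log g)) :=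
      mul_le_mul_of_nonneg_left h5 hag.le
    _ = _ := by ring

lemma half_le_log {x : ℝ} (hx : 2 ≤ x) : 1 / 2 ≤ Real.log x := by
  have h1 := Real.log_le_log two_pos hx
  have h2 := Real.log_two_gt_d9
  linarith

lemma queryCount_le {β R S γ ε δ ρ C : ℝ} {T N K : ℕ} (hγ : γ ∈ Set.Ioo (0 : ℝ) 1)
    (hε : ε ∈ Set.Ioo (0 : ℝ) 1) (hδ : δ ∈ Set.Ioo (0 : ℝ) 1) (hρ : ρ ∈ Set.Ioo (0 : ℝ) 1)
    (hR : 1 ≤ R) (hS : 1 ≤ S) (hT : 1 ≤ T) (hN : 1 ≤ N) (hK : 1 ≤ K) (hC : 0 < C)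
    (hβ : β = γ / (2 * Real.log (2 * K / δ)))
    (h : T < C * iterationBound β R S N T ε δ ρ + 1) :
    (queryCount T : ℝ) ≤ 2 * ((4 * C + 8) * (5 + 4 * Real.log (4 * (4 * C + 8)))) *
      (sampleRate R S N K γ ε δ ρ * max 1 (Real.log (sampleRate R S N K γ ε δ ρ))) := by
  obtain ⟨hγ0, hγ1⟩ := hγ
  obtain ⟨hε0, hε1⟩ := hε
  obtain ⟨hδ0, hδ1⟩ := hδ
  obtain ⟨hρ0, hρ1⟩ := hρ
  have hT' : (1 : ℝ) ≤ T := by exact_mod_cast hT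
  have hN' : (1 : ℝ) ≤ N := by exact_mod_cast hN
  have hK' : (1 : ℝ) ≤ K := by exact_mod_cast hK
  have hΛ : 1 / 2 ≤ Real.log (2 * K / δ) :=
    half_le_log (by rw [le_div_iff₀ hδ0]; nlinarith)
  have hℓ : 1 / 2 ≤ Real.log (2 * N / ρ) :=
    half_le_log (by rw [le_div_iff₀ hρ0]; nlinarith)
  set Λ := Real.log (2 * K / δ) with hΛdef
  set ℓ := Real.log (2 * N / ρ) with hℓdef
  set g := sampleRate R S N K γ ε δ ρ with hg
  have hlogT : 0 ≤ Real.log T := Real.log_nonneg hT'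
  have hgeq : g = R ^ 2 * S * Λ ^ 2 / (γ ^ 2 * ε ^ 2 * δ ^ 2) * ℓ := by
    rw [hg, sampleRate]; ring
  set B := R ^ 2 * S * Λ ^ 2 / (γ ^ 2 * ε ^ 2 * δ ^ 2) with hB
  have hB0 : 1 / 4 ≤ B := by
    rw [hB, le_div_iff₀ (by positivity)]
    have h1 : γ ^ 2 * ε ^ 2 * δ ^ 2 ≤ 1 := by
      have h2 : γ ^ 2 ≤ 1 := pow_le_one₀ hγ0.le hγ1.le
      have h3 : ε ^ 2 ≤ 1 := pow_le_one₀ hε0.le hε1.le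
      have h4 : δ ^ 2 ≤ 1 := pow_le_one₀ hδ0.le hδ1.le
      exact mul_le_one₀ (mul_le_one₀ h2 (by positivity) h3) (by positivity) h4
    have h5 : 1 ≤ R ^ 2 * S := one_le_mul_of_one_le_of_one_le (one_le_pow₀ hR) hS
    have h6 : 1 / 4 ≤ Λ ^ 2 := by nlinarith
    have h7 : 1 * Λ ^ 2 ≤ R ^ 2 * S * Λ ^ 2 := mul_le_mul_of_nonneg_right h5 (sq_nonneg Λ)
    linarith
  have hg0 : 1 / 8 ≤ g := by
    have := mul_le_mul hB0 hℓ (by norm_num) (by linarith)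
    linarith
  have hiter : iterationBound β R S N T ε δ ρ = 4 * B * (ℓ + Real.log T) := by
    have hsplit : Real.log (2 * N * T / ρ) = ℓ + Real.log T := by
      rw [hℓdef, ← Real.log_mul (by positivity) (by positivity)]
      congr 1; ring
    rw [iterationBound, hsplit, hβ, hB]
    have : Λ ≠ 0 := by linarith
    field_simp
    ring
  -- The `4` comes from `β⁻² = 4Λ²/γ²`, and the `8` absorbs the rounding `+ 1` through `g ≥ 1/8`.
  -- The bound `ℓ ≥ 1/2` moves `log T` outside the factor `ℓ`.
  have hmain : (T : ℝ) ≤ (4 * C + 8) * g * (1 + 2 * Real.log T) := by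
    have h1 : B * (ℓ + Real.log T) ≤ g * (1 + 2 * Real.log T) := by
      rw [hgeq]
      have h2 : 0 ≤ B * Real.log T := mul_nonneg (by linarith) hlogT
      have h3 : 0 ≤ B * Real.log T * (2 * ℓ - 1) := mul_nonneg h2 (by linarith)
      linarith
    have h2 : C * (B * (ℓ + Real.log T)) ≤ C * (g * (1 + 2 * Real.log T)) :=
      mul_le_mul_of_nonneg_left h1 hC.le
    have h3 : 1 ≤ 8 * (g * (1 + 2 * Real.log T)) := by
      rw [← mul_assoc]
      exact one_le_mul_of_one_le_of_one_le (by linarith) (by linarith)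
    rw [hiter] at h
    linarith
  have hfin := le_mul_max_one_log (by linarith) hT' (by linarith : 1 ≤ 4 * C + 8) hmain
  have hq : (queryCount T : ℝ) = 2 * T := by
    simp [queryCount, mul_comm]
  rw [hq]
  linarith

lemma log_div_le_two_mul_log_div {M κ ρ : ℝ} (hM : 1 ≤ M) (hκ : 0 < κ) (hρ : ρ ∈ Set.Ioo (0 : ℝ) 1)
    (h : 1 / κ ≤ M) : Real.log (M / κ) ≤ 2 * Real.log (M / ρ) := by
  have hM0 : 0 < M := by linarith
  have h1 : Real.log (M / κ) ≤ Real.log (M * M) := by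
    refine Real.log_le_log (by positivity) ?_
    rw [div_eq_mul_one_div]
    exact mul_le_mul_of_nonneg_left h hM0.le
  have h2 : Real.log M ≤ Real.log (M / ρ) :=
    Real.log_le_log hM0 (le_div_self hM0.le hρ.1 hρ.2.le)
  rw [Real.log_mul hM0.ne' hM0.ne'] at h1
  linarith

lemma optimismCoeff_mul_le {β R S κ L : ℝ} {N T : ℕ} (hβ : 0 < β) (hR : 1 ≤ R) (hS : 1 ≤ S)
    (hT : 1 ≤ T) (h0 : 0 < Real.log (2 * N * T / κ)) (h : Real.log (2 * N * T / κ) ≤ 2 * L) :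
    0 < optimismCoeff β R S N T κ ∧
      optimismCoeff β R S N T κ * (S * T) ≤ 3 / 2 * β * R * Real.sqrt (L * S * T) := by
  have hT0 : (0 : ℝ) < T := by exact_mod_cast hT
  have hS0 : 0 < S := by linarith
  have hR0 : 0 < R := by linarith
  have hL : 0 < L := by linarith
  refine ⟨mul_pos (by positivity) (Real.sqrt_pos.2 (by positivity)), ?_⟩
  have h1 : Real.sqrt (Real.log (2 * N * T / κ) / (S * T)) * (S * T)
      ≤ 3 / 2 * Real.sqrt (L * S * T) := by
    refine (sq_le_sq₀ (by positivity) (by positivity)).1 ?_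
    rw [mul_pow, mul_pow (3 / 2 : ℝ), Real.sq_sqrt (by positivity), Real.sq_sqrt (by positivity)]
    calc Real.log (2 * N * T / κ) / (S * T) * (S * T) ^ 2
        = Real.log (2 * N * T / κ) * (S * T) := by field_simp
      _ ≤ 2 * L * (S * T) := mul_le_mul_of_nonneg_right h (by positivity)
      _ ≤ (3 / 2) ^ 2 * (L * S * T) := by
        have : 0 < L * S * T := by positivity
        linarith
  have h2 : β / R ≤ β * R := by
    rw [div_le_iff₀ hR0]
    nlinarith [mul_le_mul_of_nonneg_left hR hR0.le]
  rw [optimismCoeff, mul_assoc]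
  calc β / R * (Real.sqrt (Real.log (2 * N * T / κ) / (S * T)) * (S * T))
      ≤ β * R * (3 / 2 * Real.sqrt (L * S * T)) := by gcongr
    _ = _ := by ring

lemma net_radius_bounds {η ε δ S T β R L : ℝ} (hη0 : 0 < η)
    (hη : η ≤ 1 / 40 * (ε * δ / Real.sqrt (S * T))) (hε : ε ∈ Set.Ioo (0 : ℝ) 1)
    (hδ : δ ∈ Set.Ioo (0 : ℝ) 1) (hβ : β ∈ Set.Ioo (0 : ℝ) 1) (hS : 1 ≤ S) (hT : 1 ≤ T)
    (hR : 1 ≤ R) (hL : 1 / 2 ≤ L) :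
    η ≤ 1 / 40 * (ε * δ) ∧ 40 * β ^ 2 * (T * η ^ 2) ≤ R ^ 2 * L := by
  have hST : 1 ≤ S * T := one_le_mul_of_one_le_of_one_le hS hT
  have hs : 0 < Real.sqrt (S * T) := Real.sqrt_pos.2 (by linarith)
  have hεδ0 : 0 ≤ ε * δ := mul_nonneg hε.1.le hδ.1.le
  have hεδ : ε * δ ≤ 1 := mul_le_one₀ hε.2.le hδ.1.le hδ.2.le
  refine ⟨hη.trans (mul_le_mul_of_nonneg_left
    (div_le_self hεδ0 (Real.one_le_sqrt.2 hST)) (by norm_num)), ?_⟩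
  have h1 : η * Real.sqrt (S * T) ≤ 1 / 40 := by
    have h2 : η * Real.sqrt (S * T) ≤ 1 / 40 * (ε * δ) := by
      rw [← le_div_iff₀ hs, mul_div_assoc]; exact hη
    linarith
  have h3 := pow_le_pow_left₀ (by positivity) h1 2
  rw [mul_pow, Real.sq_sqrt (by linarith)] at h3
  have h4 : T * η ^ 2 ≤ 1 / 1600 := by
    have h5 : 1 * (T * η ^ 2) ≤ S * (T * η ^ 2) :=
      mul_le_mul_of_nonneg_right hS (by positivity)
    linarith
  have h6 : β ^ 2 * (T * η ^ 2) ≤ 1 * (1 / 1600) :=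
    mul_le_mul (pow_le_one₀ hβ.1.le hβ.2.le) h4 (by positivity) zero_le_one
  have h7 : 1 * L ≤ R ^ 2 * L := mul_le_mul_of_nonneg_right (one_le_pow₀ hR) (by linarith)
  linarith

/-- Admits the choice `κ = δ` without relating `δ` to `ρ`: then `2NT/δ ≤ (2NT)²`, so its logarithm
is at most `2L`. -/
lemma one_div_le_of_iterations_le {ε δ S T β R L : ℝ} (hε : ε ∈ Set.Ioo (0 : ℝ) 1)
    (hδ : δ ∈ Set.Ioo (0 : ℝ) 1) (hβ : β ∈ Set.Ioo (0 : ℝ) 1) (hS : 1 ≤ S) (hT : 1 ≤ T)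
    (hR : 1 ≤ R) (hL : 1 / 2 ≤ L) (h : 40000 * (R ^ 2 * S * L) ≤ T * (ε * δ * β) ^ 2) :
    1 / δ ≤ T := by
  obtain ⟨hδ0, hδ1⟩ := hδ
  rw [div_le_iff₀ hδ0]
  have h2 : (ε * δ * β) ^ 2 ≤ δ := by
    have h3 : 0 ≤ ε * β := mul_nonneg hε.1.le hβ.1.le
    have h4 : (ε * β) ^ 2 ≤ 1 := pow_le_one₀ h3 (mul_le_one₀ hε.2.le hβ.1.le hβ.2.le)
    have h5 : δ ^ 2 ≤ δ := pow_le_of_le_one hδ0.le hδ1.le two_ne_zero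
    calc (ε * δ * β) ^ 2 = (ε * β) ^ 2 * δ ^ 2 := by ring
      _ ≤ 1 * δ := mul_le_mul h4 h5 (by positivity) zero_le_one
      _ = δ := one_mul δ
  have h6 : 1 * (1 / 2) ≤ R ^ 2 * S * L :=
    mul_le_mul (one_le_mul_of_one_le_of_one_le (one_le_pow₀ hR) hS) hL (by norm_num)
      (by positivity)
  have h8 : T * (ε * δ * β) ^ 2 ≤ T * δ := mul_le_mul_of_nonneg_left h2 (by linarith)
  linarith

lemma le_of_mul_le_regret_bound {ε δ S T β R L η k : ℝ} (hε : 0 < ε) (hδ : 0 < δ) (hβ : 0 < β)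
    (hS : 1 ≤ S) (hT : 1 ≤ T) (hR : 1 ≤ R) (hL : 1 / 2 ≤ L) (hη : η ≤ 1 / 40 * (ε * δ))
    (h : 40000 * (R ^ 2 * S * L) ≤ T * (ε * δ * β) ^ 2)
    (hk : T * (β * k) ≤ 16 * (R * Real.sqrt (L * S * T)) + 2 * η * β * T) :
    k ≤ ε * δ / 6 := by
  -- `40000 = 200²`; in units of `T ε δ β` the regret is then at most `16/200 + 1/20 = 0.13 < 1/6`.
  have hw : R * Real.sqrt (L * S * T) ≤ T * (ε * δ * β) / 200 := by
    refine (sq_le_sq₀ (by positivity) (by positivity)).1 ?_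
    rw [mul_pow, Real.sq_sqrt (by positivity)]
    have := mul_le_mul_of_nonneg_left h (by linarith : 0 ≤ T)
    linarith
  have h1 : 2 * η * β * T ≤ 1 / 20 * (T * (ε * δ * β)) := by
    have := mul_le_mul_of_nonneg_right hη (by positivity : 0 ≤ 2 * β * T)
    linarith
  have h2 : T * β * k ≤ T * β * (ε * δ / 6) := by
    have : 0 < T * (ε * δ * β) := by positivity
    linarith
  exact le_of_mul_le_mul_left h2 (by positivity)

end Rates

end XPO

/-! ### The main theorem. -/

theorem mainTheorem4 :
    ∃ c C C' : ℝ, 0 < c ∧ 0 < C ∧ 0 < C' ∧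
      ∀ (X : Type*) (Y : Type*) [MeasurableSpace X] [MeasurableSpace Y] [Fintype Y]
        [MeasurableSingletonClass Y]
        (μ : Measure X) [IsProbabilityMeasure μ]
        (base : Kernel X Y) [IsMarkovKernel base]
        (models : Set (Kernel X Y)) (_ : ∀ π ∈ models, IsMarkovKernel π)
        (ε δ γ ρ β R εdisc S : ℝ) (T N : ℕ),
        ε ∈ Set.Ioo (0 : ℝ) 1 → δ ∈ Set.Ioo (0 : ℝ) 1 → γ ∈ Set.Ioo (0 : ℝ) 1 →
        ρ ∈ Set.Ioo (0 : ℝ) 1 → β ∈ Set.Ioo (0 : ℝ) 1 → εdisc ∈ Set.Ioo (0 : ℝ) 1 →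
        1 ≤ T →
        -- bounded log-probabilities
        (∀ x y, 0 < XPO.prob base x y ∧ 1 + Real.log (1 / XPO.prob base x y) ≤ R) →
        XPO.BoundedDensityRatios base models β R →
        -- margin, size of the regularization parameter, realizability
        XPO.MarginCondition μ base γ →
        2 * γ⁻¹ * Real.log (2 * Fintype.card Y / δ) ≤ β⁻¹ →
        (∃ π ∈ models, XPO.IsPowerTilt base β π) →
        -- complexity of the model class
        S = max (XPO.SEC μ models (XPO.selfReward base) T β (R ^ 2) base) 1 →
        XPO.coveringNumber models εdisc = N →
        C * XPO.iterationBound β R S N T ε δ ρ ≤ T →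
        εdisc ≤ c * (ε * δ / Real.sqrt (S * T)) →
        -- every run of the algorithm succeeds with probability at least `1 - ρ`
        (∀ (α : ℝ) (A : XPO.Rule X Y),
          (α = XPO.optimismCoeff β R S N T δ ∨ α = XPO.optimismCoeff β R S N T ρ) →
          XPO.IsXPORule base (XPO.selfReward base) models T β α A →
          ∃ G : Set (Fin T → X × Y × Y), MeasurableSet G ∧
            1 - ρ ≤ (XPO.datasetLaw μ base A T).real G ∧
            ∀ D ∈ G, ∀ out : Kernel X Y,
              XPO.IsOutput μ base (XPO.selfReward base) β A D out →
              (base ∈ models → out ∈ models) ∧ XPO.IsSharpened μ base out ε δ) ∧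
        -- sample complexity for the tuned `β` and the smallest number of iterations
        (β = γ / (2 * Real.log (2 * Fintype.card Y / δ)) →
          T < C * XPO.iterationBound β R S N T ε δ ρ + 1 →
          (XPO.queryCount T : ℝ) ≤
            C' * (XPO.sampleRate R S N (Fintype.card Y) γ ε δ ρ *
              max 1 (Real.log (XPO.sampleRate R S N (Fintype.card Y) γ ε δ ρ)))) := by
  refine ⟨1 / 40, 40000, 2 * ((4 * 40000 + 8) * (5 + 4 * Real.log (4 * (4 * 40000 + 8)))),
    by norm_num, by norm_num, ?_, ?_⟩
  · have : 0 ≤ Real.log (4 * (4 * 40000 + 8) : ℝ) := Real.log_nonneg (by norm_num)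
    positivity
  intro X Y _ _ _ _ μ _ base _ models hmodels ε δ γ ρ β R η S T N hε hδ hγ hρ hβ hη hT hR hbd
    hmargin hβγ hreal hSdef hNdef hTbound hηbound
  obtain ⟨tilt, htm, ht⟩ := hreal
  have := hmodels tilt htm
  obtain ⟨x0⟩ : Nonempty X := nonempty_of_isProbabilityMeasure μ
  have hY := XPO.nonempty_responses base x0
  have hb : ∀ x y, 0 < XPO.prob base x y := fun x y => (hR x y).1
  have htb : XPO.BoundedRatio base β R tilt := hbd tilt htm
  -- The self-reward lies in `[1 - R, 0]`, so this interval is nonempty.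
  have hR1 : 1 ≤ R := by
    obtain ⟨y0⟩ := hY
    have := XPO.selfReward_mem hR x0 y0
    linarith
  have hR0 : 0 < R := by linarith
  have hS1 : 1 ≤ S := hSdef ▸ le_max_right _ _
  have hS0 : 0 < S := by linarith
  obtain ⟨Ψ, hΨ, hΨN⟩ := XPO.exists_net_card_le hNdef
  have hN1 : 1 ≤ N := by
    obtain ⟨π', hπ', -⟩ := hΨ.2 tilt htm
    exact (Finset.card_pos.2 ⟨π', hπ'⟩).trans_le hΨN
  have hT0 : (1 : ℝ) ≤ T := by exact_mod_cast hT
  have hN0 : (1 : ℝ) ≤ N := by exact_mod_cast hN1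
  have hK : 1 ≤ Fintype.card Y := Fintype.card_pos
  have hβ0 := hβ.1
  have hε0 := hε.1
  have hδ0 := hδ.1
  have hρ0 := hρ.1
  refine ⟨fun α A hα hA => ?_, fun hβeq hTlt =>
    XPO.queryCount_le hγ hε hδ hρ hR1 hS1 hT hN1 hK (by norm_num) hβeq hTlt⟩
  have hNT : 1 ≤ (N : ℝ) * T := one_le_mul_of_one_le_of_one_le hN0 hT0
  set L := Real.log (2 * N * T / ρ) with hL
  have hLhalf : 1 / 2 ≤ L := XPO.half_le_log (by
    rw [le_div_iff₀ hρ0]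
    nlinarith [hρ.2])
  have hL0 : 0 < L := by linarith
  have hTsq : 40000 * (R ^ 2 * S * L) ≤ T * (ε * δ * β) ^ 2 := by
    rw [XPO.iterationBound, ← mul_div_assoc, div_le_iff₀ (by positivity)] at hTbound
    refine hTbound.trans (le_of_eq ?_)
    ring
  obtain ⟨hηle, hη40⟩ := XPO.net_radius_bounds hη.1 hηbound hε hδ hβ hS1 hT0 hR1 hLhalf
  have hδT : 1 / δ ≤ 2 * N * T := by
    have := XPO.one_div_le_of_iterations_le hε hδ hβ hS1 hT0 hR1 hLhalf hTsq
    have : 1 * (T : ℝ) ≤ N * T := mul_le_mul_of_nonneg_right hN0 (by linarith)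
    linarith
  have hαbounds : 0 < α ∧ α * (S * T) ≤ 3 / 2 * β * R * Real.sqrt (L * S * T) := by
    have hM : 1 ≤ 2 * (N : ℝ) * T := by linarith
    rcases hα with rfl | rfl
    · refine XPO.optimismCoeff_mul_le hβ0 hR1 hS1 hT (Real.log_pos ?_)
        (XPO.log_div_le_two_mul_log_div hM hδ0 hρ hδT)
      rw [one_lt_div hδ0]; linarith [hδ.2]
    · exact XPO.optimismCoeff_mul_le hβ0 hR1 hS1 hT hL0 (by linarith)
  obtain ⟨hα0, hαS⟩ := hαbounds
  have hexpL : 2 * N * T * Real.exp (-L) ≤ ρ := by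
    rw [hL, Real.exp_neg, Real.exp_log (by positivity)]
    refine le_of_eq ?_
    field_simp
  obtain ⟨G, hGm, hGp, hG⟩ := XPO.exists_measurableSet_concentrates μ (T := T) hA.markov hR hβ0 hR0
    hL0 htb (fun π hπ => hbd π (hΨ.1 hπ)) hΨN hexpL
  refine ⟨G, hGm, hGp, fun D hD out hout => ?_⟩
  obtain ⟨t, rfl, hmax⟩ := hout
  have hmem : ∀ s : Fin (T + 1), A.iterate D s = base ∨ A.iterate D s ∈ models := by
    intro s
    rcases Nat.eq_zero_or_pos (s : ℕ) with hs | hs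
    · left
      obtain rfl : s = 0 := Fin.ext hs
      exact hA.init _
    · right
      exact hA.mem _ hs (Nat.le_of_lt_succ s.isLt) _
  have hbase : XPO.BoundedRatio base β R base := fun x y => ⟨hb x y, by
    simpa [div_self (hb x y).ne'] using hR0.le⟩
  have hbdr : ∀ s, XPO.BoundedRatio base β R (A.iterate D s) := fun s => by
    rcases hmem s with h | h
    · rw [h]; exact hbase
    · exact hbd _ h
  have hmark : ∀ s, IsMarkovKernel (A.iterate D s) := fun s => by
    have := hA.markov s
    unfold XPO.Rule.iterate XPO.Rule.model; infer_instance
  refine ⟨fun hbm => (hmem t).elim (fun h => h ▸ hbm) id, ?_⟩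
  have hpm : ∀ j : Fin T, A.iterate D j.succ ∈ models := fun j =>
    hA.mem _ (Nat.succ_pos _) j.isLt _
  -- The SEC is applied to `π^(2), …, π^(T+1)`: exactly `T` models, all in the class even when
  -- `base` is not.
  have hsec : XPO.secSum μ base (XPO.selfReward base) β (R ^ 2) (fun j => A.iterate D j.succ)
      ≤ S :=
    (XPO.secSum_le_SEC μ hmodels hR hR0 hbd fun j => ⟨A.iterate D j.succ, hpm j⟩).trans
      (hSdef ▸ le_max_left _ _)
  have hregret := XPO.sum_regret_le μ hA.markov hR hβ0 ht htb hR1 hLhalf hS1 hα0 hαS hη40 D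
    (fun j => A.iterate D j.succ) (fun j => rfl) (fun j => hbdr _) hsec
    (fun j => by
      obtain ⟨π', hπ', hnear⟩ := hΨ.2 _ (hpm j)
      exact ⟨π', hbd _ (hΨ.1 hπ'), fun z => hnear z.1 z.2, hG D hD π' hπ' j⟩)
    (fun j => hA.minimizes _ (Nat.succ_pos _) j.isLt _ tilt htm)
  -- Maximal `J_β` means minimal divergence from `tilt`, so `T` times the regret of the output is at
  -- most the cumulative regret.
  have hle : ∀ j : Fin T,
      β * ∫ z, XPO.logRatio (A.iterate D t) tilt z ∂(μ ⊗ₘ A.iterate D t)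
        ≤ β * ∫ z, XPO.logRatio (A.iterate D j.succ) tilt z ∂(μ ⊗ₘ A.iterate D j.succ) := by
    intro j
    have := hmark t
    have := hmark j.succ
    have h := hmax j.succ
    rw [XPO.regValue_eq μ hR hβ0 ht htb (hbdr _), XPO.regValue_eq μ hR hβ0 ht htb (hbdr _)] at h
    linarith
  have hsum := (Finset.sum_le_sum fun j (_ : j ∈ Finset.univ) => hle j).trans hregret
  simp only [Finset.sum_const, Finset.card_univ, Fintype.card_fin, nsmul_eq_mul] at hsum
  have := hmark t
  exact XPO.isSharpened_of_integral_le μ hb hβ0 hγ hδ0 ht htb hβγ hmargin (hbdr t)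
    (XPO.le_of_mul_le_regret_bound hε0 hδ0 hβ0 hS1 hT0 hR1 hLhalf hηle hTsq hsum)
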